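/- Fix a universe of small sets and let $\mathbf{Set}$ be the category of small sets; all categories are locally small. For a small category $K$ with finite limits, a presheaf $\varphi\colon K^{\mathrm{op}}\to\mathbf{Set}$ is called a lex-weight on $K$. For a class $\Phi$ of lex-weights and a category $\mathcal C$ with finite limits, let $\Phi\mathcal C$ be the smallest full replete subcategory of $[\mathcal C^{\mathrm{op}},\mathbf{Set}]$ that contains the representables and is closed under finite limits and under the weighted colimits $\varphi\star D$ with $\varphi\in\Phi$ a lex-weight on $K$ and $D\colon K\to[\mathcal C^{\mathrm{op}},\mathbf{Set}]$ a finite-limit-preserving functor with values in the subcategory. The category $\mathcal C$ is called $\Phi$-exact if the restricted Yoneda embedding $\mathcal C\to\Phi\mathcal C$ has a left adjoint that preserves finite limits. Let $\Phi_{\mathrm{rc}}$ be the class with the single member $\varphi\colon K^{\mathrm{op}}\to\mathbf{Set}$, where $K$ is the free category with finite limits generated by a reflexive pair $d,c\colon X\rightrightarrows Y$ (with a common splitting $r\colon Y\to X$, $dr=cr=1_Y$), and $\varphi$ is the coequaliser of $K(-,d)$ and $K(-,c)$ in $[K^{\mathrm{op}},\mathbf{Set}]$. A category is Barr-exact if it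 is regular and every internal equivalence relation in it is a kernel-pair. For a relation $R\rightarrowtail X\times X$ write $R^\circ$ for the opposite relation, and $RS$ for the composite of relations (formed by pullback and image). **Proposition.** Let $\mathcal C$ be a category with finite limits. The following are equivalent: 1. $\mathcal C$ is $\Phi_{\mathrm{rc}}$-exact; 2. $\mathcal C$ is Barr-exact, and for every reflexive relation $R\rightarrowtail X\times X$ in $\mathcal C$, the chain $R\subseteq RR^\circ R\subseteq RR^\circ RR^\circ R\subseteq\cdots$ of subobjects of $X\times X$, regarded as a diagram in $\mathcal C$, has a colimit that is stable under pullback; 3. $\mathcal C$ is Barr-exact, and for every reflexive relation $R\rightarrowtail X\times X$ in $\mathcal C$, the chain $R\subseteq RR^\circ R\subseteq RR^\circ RR^\circ R\subseteq\cdots$ has an effective, pullback-stable union: there is a subobject $U$ of $X\times X$ which is the join of the chain in the poset of subobjects of $X\times X$ and its colimit in $\mathcal C$, and for every $f\colon Y\to X\times X$ the subobject $f^*U$ of $Y$ is likewise the join, and the colimit in $\mathcal C$, of the pulled-back chain. -/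

import Mathlib

open CategoryTheory CategoryTheory.Limits Opposite

universe w u

noncomputable section

namespace LexColimits

/-! ### Weighted colimits and lex-weights -/

/-- A presheaf `W : Kᵒᵖ ⥤ Set` and a functor `D : K ⥤ E` give the diagram of shape
`(el W)ᵒᵖ` in `E`, sending `(k, x ∈ W k)` to `D k`; the weighted colimit `W ⋆ D` is the colimit
of this diagram. -/
abbrev weightedDiagram {K : Type*} [Category* K] {E : Type*} [Category* E]
    (W : Kᵒᵖ ⥤ Type w) (D : K ⥤ E) : W.Elementsᵒᵖ ⥤ E :=
  (CategoryOfElements.π W).leftOp ⋙ D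

/-- A lex-weight: a presheaf (not assumed to preserve any limits) on a small category with
finite limits. -/
structure LexWeight : Type (w + 1) where
  /-- the domain -/
  K : Type w
  [category : SmallCategory K]
  [hasFiniteLimits : HasFiniteLimits K]
  /-- the presheaf -/
  weight : Kᵒᵖ ⥤ Type w

attribute [instance] LexWeight.category LexWeight.hasFiniteLimits

/-! ### The free `Φ`-exact completion and `Φ`-exactness -/

section Exactness

variable (Φ : Set LexWeight.{w}) (C : Type u) [Category.{w} C]

/-- A full replete subcategory `Q` of the presheaf category `[Cᵒᵖ, Set]` which contains the
representables and is closed under finite limits and under `Φ`-lex-colimits, that is, under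
weighted colimits `φ ⋆ D` with `φ : Kᵒᵖ ⥤ Set` in `Φ` and `D` a finite-limit-preserving functor
defined on `K`. (Repleteness is closure under limits of shape the terminal category.) -/
structure IsLexClosed (Q : ObjectProperty (Cᵒᵖ ⥤ Type w)) : Prop where
  yoneda_mem (X : C) : Q (yoneda.obj X)
  limits_mem : ∀ (J : Type) [SmallCategory J] [FinCategory J], Q.IsClosedUnderLimitsOfShape J
  lexColimits_mem (φ : LexWeight.{w}) (_ : φ ∈ Φ) (D : φ.K ⥤ Cᵒᵖ ⥤ Type w)
    (_ : PreservesFiniteLimits D) (_ : ∀ k : φ.K, Q (D.obj k))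
    (c : Cocone (weightedDiagram φ.weight D)) (_ : IsColimit c) : Q c.pt

/-- The closure of the representables in `[Cᵒᵖ, Set]` under finite limits and
`Φ`-lex-colimits: the smallest `Q` satisfying `IsLexClosed Φ C Q`. -/
def lexClosure : ObjectProperty (Cᵒᵖ ⥤ Type w) :=
  fun P => ∀ Q : ObjectProperty (Cᵒᵖ ⥤ Type w), IsLexClosed Φ C Q → Q P

/-- The category `Φ C`: the full subcategory of `[Cᵒᵖ, Set]` on `lexClosure Φ C`. -/
abbrev Completion := (lexClosure Φ C).FullSubcategory

/-- The restricted Yoneda embedding `W : C ⥤ Φ C`. -/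
def completionUnit : C ⥤ Completion Φ C :=
  (lexClosure Φ C).lift yoneda fun X _ hQ => hQ.yoneda_mem X

/-- `C` is `Φ`-exact when the restricted Yoneda embedding `W : C ⥤ Φ C` has a left adjoint which
preserves finite limits. -/
def IsExact [HasFiniteLimits C] : Prop :=
  ∃ L : Completion Φ C ⥤ C, Nonempty (L ⊣ completionUnit Φ C) ∧ PreservesFiniteLimits L

end Exactness

/-! ### The class of lex-weights for reflexive coequalisers -/

section FreeLex

variable (A : Type) [SmallCategory A] [FinCategory A]

/-- The free category with finite limits on a finite category `A`. It is the opposite of the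
closure of the representables in `[A, Set]` under finite colimits; as `A` is finite, that closure
consists of the functors `A ⥤ Set` with finite values. (Finite sets are taken in their standard
skeleton, so that the category is small.) -/
abbrev FreeLex : Type w := (A ⥤ FintypeCat.Skeleton.{w})ᵒᵖ

instance : HasFiniteColimits FintypeCat.Skeleton.{w} where
  out _ _ _ :=
    Adjunction.hasColimitsOfShape_of_equivalence FintypeCat.Skeleton.equivalence.functor

instance : HasFiniteColimits (A ⥤ FintypeCat.Skeleton.{w}) where
  out _ _ _ := inferInstance

/-- The corepresentable functor `A(a, -)`, as a functor to finite sets. -/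
def finCoyoneda : Aᵒᵖ ⥤ A ⥤ FintypeCat.{w} where
  obj a :=
    { obj b := FintypeCat.of (ULift.{w} (a.unop ⟶ b))
      map f := FintypeCat.homMk fun x => ⟨x.down ≫ f⟩
      map_id _ := FintypeCat.hom_ext _ _ fun x => congrArg ULift.up (Category.comp_id x.down)
      map_comp f g := FintypeCat.hom_ext _ _ fun x =>
        congrArg ULift.up (Category.assoc x.down f g).symm }
  map h :=
    { app _ := FintypeCat.homMk fun x => ⟨h.unop ≫ x.down⟩
      naturality _ _ f := FintypeCat.hom_ext _ _ fun x =>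
        congrArg ULift.up (Category.assoc h.unop x.down f).symm }
  map_id _ := NatTrans.ext (funext fun _ => FintypeCat.hom_ext _ _ fun x =>
    congrArg ULift.up (Category.id_comp x.down))
  map_comp g h := NatTrans.ext (funext fun _ => FintypeCat.hom_ext _ _ fun x =>
    congrArg ULift.up (Category.assoc h.unop g.unop x.down))

/-- The universal functor from `A` to its free completion under finite limits, sending `a` to
`A(a, -)`. -/
def freeLexUnit : A ⥤ FreeLex.{w} A :=
  (finCoyoneda.{w} A ⋙
    (Functor.whiskeringRight A _ _).obj FintypeCat.Skeleton.equivalence.{w}.inverse).rightOp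

end FreeLex

instance : Fintype WalkingReflexivePair where
  elems := {.zero, .one}
  complete x := by cases x <;> simp

instance (a b : WalkingReflexivePair) : Finite (a ⟶ b) := by
  refine Finite.of_injective (β := Fin 6) (fun f : WalkingReflexivePair.Hom a b => match f with
    | .left => 0
    | .right => 1
    | .reflexion => 2
    | .leftCompReflexion => 3
    | .rightCompReflexion => 4
    | .id _ => 5) fun f g h => ?_
  change WalkingReflexivePair.Hom a b at f g
  cases f <;> cases g <;> first | rfl | exact absurd h (by decide)

instance : FinCategory WalkingReflexivePair where
  fintypeHom _ _ := Fintype.ofFinite _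

/-- The lex-weight for coequalisers of reflexive pairs. Its domain is the free category with finite
limits on a reflexive pair `d, c : X ⇉ Y`, and the presheaf is the coequaliser of `K(-, d)` and
`K(-, c)` in `[Kᵒᵖ, Set]`. -/
def reflexiveCoequalizerWeight : LexWeight.{w} where
  K := FreeLex.{w} WalkingReflexivePair
  weight := coequalizer
    (yoneda.map ((freeLexUnit.{w} WalkingReflexivePair).map WalkingReflexivePair.Hom.left))
    (yoneda.map ((freeLexUnit.{w} WalkingReflexivePair).map WalkingReflexivePair.Hom.right))

/-- The class `Φ_rc`, with one member. -/
def reflexiveCoequalizerClass : Set LexWeight.{w} := {reflexiveCoequalizerWeight}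

/-! ### Barr-exact categories and internal relations -/

/-- A Barr-exact category: a regular category in which every internal equivalence relation is
effective, that is, is the kernel-pair of some morphism. -/
class BarrExact (C : Type u) [Category.{w} C] : Prop extends Regular C where
  exists_isKernelPair {R X : C} (p₁ p₂ : R ⟶ X) (_ : IsEquivalenceRelation p₁ p₂) :
    ∃ (Y : C) (q : X ⟶ Y), IsKernelPair q p₁ p₂

section Relations

variable {C : Type u} [Category.{w} C] [Regular C] {X Y Z : C}

/-- The composite of relations `R ↣ X × Y` and `S ↣ Y × Z`: the image in `X × Z` of the pullback
`R ×_Y S`; in elements `{(x, z) | ∃ y, (x, y) ∈ R ∧ (y, z) ∈ S}`. -/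
def relComp (R : Subobject (X ⨯ Y)) (S : Subobject (Y ⨯ Z)) : Subobject (X ⨯ Z) :=
  imageSubobject (prod.lift
    (pullback.fst (R.arrow ≫ prod.snd) (S.arrow ≫ prod.fst) ≫ R.arrow ≫ prod.fst)
    (pullback.snd (R.arrow ≫ prod.snd) (S.arrow ≫ prod.fst) ≫ S.arrow ≫ prod.snd))

/-- The opposite relation `R° ↣ Y × X` of `R ↣ X × Y`. -/
def relOp (R : Subobject (X ⨯ Y)) : Subobject (Y ⨯ X) :=
  (Subobject.pullback (prod.braiding Y X).hom).obj R

/-- A relation `R ↣ X × X` is reflexive when it contains the diagonal. -/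
abbrev IsReflexiveRel (R : Subobject (X ⨯ X)) : Prop := R.Factors (diag X)

lemma IsReflexiveRel.op {R : Subobject (X ⨯ X)} (hR : IsReflexiveRel R) :
    IsReflexiveRel (relOp R) := by
  have hw : R.factorThru (diag X) hR ≫ R.arrow = diag X ≫ (prod.braiding X X).hom := by
    have h₁ : R.factorThru (diag X) hR ≫ R.arrow = diag X := Subobject.factorThru_arrow _ _ hR
    rw [h₁]
    ext <;> simp [prod.lift_fst, prod.lift_snd]
  have h := (Subobject.isPullback (prod.braiding X X).hom R).lift_snd _ _ hw
  exact (congrArg (Subobject.Factors (relOp R)) h).mp (Subobject.factors_comp_arrow _)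

lemma le_relComp (S : Subobject (X ⨯ Y)) {T : Subobject (Y ⨯ Y)} (hT : IsReflexiveRel T) :
    S ≤ relComp S T := by
  have hd : T.factorThru (diag Y) hT ≫ T.arrow = diag Y := Subobject.factorThru_arrow _ _ hT
  have hw : 𝟙 _ ≫ S.arrow ≫ prod.snd =
      ((S.arrow ≫ prod.snd) ≫ T.factorThru (diag Y) hT) ≫ T.arrow ≫ prod.fst := by
    rw [Category.assoc, reassoc_of% hd]
    simp [prod.lift_fst]
  refine Subobject.le_of_comm (pullback.lift _ _ hw ≫ factorThruImageSubobject _) ?_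
  refine (Category.assoc _ _ _).trans
    ((congrArg (_ ≫ ·) (imageSubobject_arrow_comp _)).trans ?_)
  ext
  · simp [prod.lift_fst, pullback.lift_fst_assoc]
  · simp [prod.lift_snd, pullback.lift_snd_assoc, reassoc_of% hd]

/-- The terms of the chain `R, R R° R, R R° R R° R, …`. -/
def relChainAux (R : Subobject (X ⨯ X)) : ℕ → Subobject (X ⨯ X)
  | 0 => R
  | n + 1 => relComp (relComp (relChainAux R n) (relOp R)) R

/-- The chain `R ≤ R R° R ≤ R R° R R° R ≤ …` of subobjects of `X × X`, for a reflexive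
relation `R`. -/
def relChain (R : Subobject (X ⨯ X)) (hR : IsReflexiveRel R) : ℕ →o Subobject (X ⨯ X) where
  toFun := relChainAux R
  monotone' := monotone_nat_of_le_succ fun _ =>
    (le_relComp _ hR.op).trans (le_relComp _ hR)

end Relations

/-! ### Unions of chains of subobjects -/

section Unions

variable {C : Type u} [Category.{w} C]

/-- A chain of subobjects, as a diagram of shape `ℕ` in `C`. -/
def chainDiagram {Z : C} (c : ℕ →o Subobject Z) : ℕ ⥤ C :=
  c.monotone.functor ⋙ Subobject.underlying

/-- The cocone of inclusions of the members of a chain into an upper bound. -/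
def chainCocone {Z : C} (c : ℕ →o Subobject Z) (U : Subobject Z) (h : ∀ n, c n ≤ U) :
    Cocone (chainDiagram c) where
  pt := U
  ι :=
    { app n := Subobject.ofLE _ _ (h n)
      naturality m n f := by
        rw [← cancel_mono U.arrow]
        refine (Category.assoc _ _ _).trans ?_
        simp only [Functor.const_obj_map]
        have h₁ : (chainDiagram c).map f ≫ (c n).arrow = (c m).arrow :=
          Subobject.underlying_arrow (c.monotone.functor.map f)
        have h₂ : Subobject.ofLE _ _ (h n) ≫ U.arrow = (c n).arrow := Subobject.ofLE_arrow _
        have h₃ : Subobject.ofLE _ _ (h m) ≫ U.arrow = (c m).arrow := Subobject.ofLE_arrow _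
        erw [h₂, h₁, Category.comp_id, h₃] }

/-- `U` is an effective union of the chain `c` of subobjects of `Z`: it is the join of the chain
in the poset of subobjects of `Z`, and the inclusions exhibit it as the colimit of the chain
in `C`. -/
structure IsEffectiveUnion {Z : C} (c : ℕ →o Subobject Z) (U : Subobject Z) : Prop where
  isLUB : IsLUB (Set.range c) U
  effective : Nonempty (IsColimit (chainCocone c U fun n => isLUB.1 (Set.mem_range_self n)))

variable [HasPullbacks C]

/-- The pullback of a chain of subobjects of `Z` along `f : Y ⟶ Z`. -/
def pullbackChain {Y Z : C} (f : Y ⟶ Z) (c : ℕ →o Subobject Z) : ℕ →o Subobject Y where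
  toFun n := (Subobject.pullback f).obj (c n)
  monotone' _ _ h := (Subobject.pullback f).monotone (c.monotone h)

/-- `U` is an effective, pullback-stable union of the chain `c` of subobjects of `Z`: it is an
effective union, and it remains one upon pulling back along any `f : Y ⟶ Z`. -/
def IsStableEffectiveUnion {Z : C} (c : ℕ →o Subobject Z) (U : Subobject Z) : Prop :=
  IsEffectiveUnion c U ∧
    ∀ ⦃Y : C⦄ (f : Y ⟶ Z), IsEffectiveUnion (pullbackChain f c) ((Subobject.pullback f).obj U)

/-- The chain `c`, as a diagram in `C`, has a pullback-stable colimit. -/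
def HasStableColimit {Z : C} (c : ℕ →o Subobject Z) : Prop :=
  ∃ t : Cocone (chainDiagram c), Nonempty (IsColimit t) ∧ IsUniversalColimit t

end Unions

end LexColimits

end

noncomputable section

namespace LexColimits

/-! ### The canonical topology -/

section Canonical

variable {C : Type u} [Category.{w} C]

/-! The three conditions are compared through the canonical topology, the finest one for which
representables are sheaves. Conditions 2 and 3 both amount to Barr-exactness together with
`ChainsCover`: for each reflexive `R`, the chain canonically covers some subobject `U` bounding it.
Two generalized elements are then related by `U` exactly when they are locally related by the
equivalence relation generated by `R` (`holds_iff_eqvSieve_mem`).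

Covers give exactness (`isExact_of_chainsCover`). Presheaves whose canonical sheafification is
representable are closed under finite limits. They are also closed under reflexive coequalisers: for
a reflexive pair in `C` with image `R`, the relation `U` is an equivalence relation, Barr-exactness
provides its quotient, and this is a coequaliser even among sheaves (`exists_quotient`). Hence they
include the whole completion, and sheafification restricts to a lex left adjoint.

Conversely, if the restricted Yoneda embedding has a lex left adjoint, each component of the unit is
locally bijective (`isLocallyBijective_unit`). Applied to the presheaf coequaliser of a reflexive
pair, which lies in the completion by `lexClosure_of_coequalizer`, this gives every reflexive pair
in `C` a quotient for the canonical topology (`HasLocalQuotients`). Kernel pairs, equivalence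
relations and reflexive relations are all reflexive pairs, so regularity, effectivity and covering
by chains follow from this single property. -/

lemma mem_canonicalTopology_iff {X : C} {S : Sieve X} :
    S ∈ Sheaf.canonicalTopology C X ↔
      ∀ ⦃Y : C⦄ (f : Y ⟶ X) (W : C),
        Presieve.IsSheafFor (yoneda.obj W) (S.pullback f).arrows := by
  refine ⟨fun hS Y f W => ?_, fun h => ?_⟩
  · exact Sheaf.isSheaf_yoneda_obj W _ ((Sheaf.canonicalTopology C).pullback_stable f hS)
  · refine Sheaf.mem_finestTopology_of_forall_isSheafFor ?_
    rintro _ ⟨W, rfl⟩ Y f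
    exact h f W

/-- The sheaf condition for a representable presheaf, in terms of morphisms. -/
lemma isSheafFor_yoneda_iff {X W : C} {S : Sieve X} :
    Presieve.IsSheafFor (yoneda.obj W) S.arrows ↔
      ∀ x : (∀ ⦃Y : C⦄ (f : Y ⟶ X), S f → (Y ⟶ W)),
        (∀ ⦃Y Z : C⦄ (f : Y ⟶ X) (hf : S f) (g : Z ⟶ Y),
          x (g ≫ f) (S.downward_closed hf g) = g ≫ x f hf) →
        ∃! t : X ⟶ W, ∀ ⦃Y : C⦄ (f : Y ⟶ X) (hf : S f), f ≫ t = x f hf := by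
  constructor
  · intro h x hx
    exact h (fun Y f hf => x f hf)
      ((Presieve.compatible_iff_sieveCompatible _).2 fun Y Z f g hf => hx f hf g)
  · intro h x hx
    rw [Presieve.compatible_iff_sieveCompatible] at hx
    exact h (fun Y f hf => x f hf) (fun Y Z f hf g => hx f g hf)

lemma hom_ext_of_cover {X W : C} {S : Sieve X} (hS : S ∈ Sheaf.canonicalTopology C X)
    {a b : X ⟶ W} (h : ∀ ⦃Y : C⦄ (f : Y ⟶ X), S f → f ≫ a = f ≫ b) : a = b :=
  (Sheaf.isSheaf_yoneda_obj W S hS).isSeparatedFor.ext fun _ f hf => h f hf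

lemma exists_glue {X W : C} {S : Sieve X} (hS : S ∈ Sheaf.canonicalTopology C X)
    (x : ∀ ⦃Y : C⦄ (f : Y ⟶ X), S f → (Y ⟶ W))
    (hx : ∀ ⦃Y Z : C⦄ (f : Y ⟶ X) (hf : S f) (g : Z ⟶ Y),
      x (g ≫ f) (S.downward_closed hf g) = g ≫ x f hf) :
    ∃ t : X ⟶ W, ∀ ⦃Y : C⦄ (f : Y ⟶ X) (hf : S f), f ≫ t = x f hf :=
  (isSheafFor_yoneda_iff.1 (Sheaf.isSheaf_yoneda_obj W S hS) x hx).exists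

/-- Local lifts through a monomorphism are unique, hence compatible, hence glue. -/
lemma exists_lift_of_cover {X Y Z : C} {S : Sieve X} (hS : S ∈ Sheaf.canonicalTopology C X)
    (m : Y ⟶ Z) [Mono m] (f : X ⟶ Z)
    (h : ∀ ⦃V : C⦄ (g : V ⟶ X), S g → ∃ l : V ⟶ Y, l ≫ m = g ≫ f) : ∃ l : X ⟶ Y, l ≫ m = f := by
  choose l hl using h
  obtain ⟨t, ht⟩ := exists_glue hS l fun V V' f hf g => by
    rw [← cancel_mono m, hl, Category.assoc, Category.assoc, hl]
  exact ⟨t, hom_ext_of_cover hS fun V g hg => by rw [← Category.assoc, ht g hg, hl]⟩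

lemma factors_of_cover {X Z : C} {S : Sieve X} (hS : S ∈ Sheaf.canonicalTopology C X)
    (U : Subobject Z) (f : X ⟶ Z) (h : ∀ ⦃V : C⦄ (g : V ⟶ X), S g → U.Factors (g ≫ f)) :
    U.Factors f := by
  obtain ⟨l, hl⟩ := exists_lift_of_cover hS U.arrow f fun V g hg =>
    ⟨U.factorThru _ (h g hg), U.factorThru_arrow _ _⟩
  exact hl ▸ Subobject.factors_comp_arrow l

end Canonical

/-! ### Canonical covers by chains -/

section Chains

variable {C : Type u} [Category.{w} C]

/-- The sieve of those morphisms `g` for which `g ≫ f` lifts to a leg of the cocone `t`. -/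
def coconeSieve {J : Type*} [Category* J] {F : J ⥤ C} (t : Cocone F) {Y : C} (f : Y ⟶ t.pt) :
    Sieve Y where
  arrows V g := ∃ (n : J) (h : V ⟶ F.obj n), h ≫ t.ι.app n = g ≫ f
  downward_closed := by
    rintro V V' g ⟨n, h, e⟩ k
    exact ⟨n, k ≫ h, by simp [e]⟩

lemma coconeSieve_pullback {J : Type*} [Category* J] {F : J ⥤ C} (t : Cocone F) {Y Y' : C}
    (f : Y ⟶ t.pt) (g : Y' ⟶ Y) : (coconeSieve t f).pullback g = coconeSieve t (g ≫ f) := by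
  ext V k
  simp [coconeSieve]

/-- A cocone of monomorphisms under a sequence is a colimit if it is a canonical cover. -/
lemma nonempty_isColimit_of_coconeSieve_mem {F : ℕ ⥤ C} (t : Cocone F)
    [∀ n, Mono (t.ι.app n)] (ht : coconeSieve t (𝟙 _) ∈ Sheaf.canonicalTopology C t.pt) :
    Nonempty (IsColimit t) := by
  have key (s : Cocone F) : ∃ d : t.pt ⟶ s.pt, ∀ n, t.ι.app n ≫ d = s.ι.app n := by
    -- Monic legs enter here: two factorizations of one morphism through stages `n` and `m` already
    -- agree at stage `max n m`.
    have huniq {V : C} {n m : ℕ} (a : V ⟶ F.obj n) (b : V ⟶ F.obj m)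
        (h : a ≫ t.ι.app n = b ≫ t.ι.app m) : a ≫ s.ι.app n = b ≫ s.ι.app m := by
      have : a ≫ F.map (homOfLE (le_max_left n m)) = b ≫ F.map (homOfLE (le_max_right n m)) := by
        rw [← cancel_mono (t.ι.app (max n m))]
        simpa using h
      rw [← s.w (homOfLE (le_max_left n m)), reassoc_of% this, s.w]
    have hex ⦃Y : C⦄ (f : Y ⟶ t.pt) (hf : coconeSieve t (𝟙 _) f) :
        ∃ y : Y ⟶ s.pt, ∀ (n : ℕ) (h : Y ⟶ F.obj n), h ≫ t.ι.app n = f → y = h ≫ s.ι.app n := by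
      obtain ⟨n, h, e⟩ := hf
      rw [Category.comp_id] at e
      exact ⟨h ≫ s.ι.app n, fun m k ek => huniq _ _ (e.trans ek.symm)⟩
    choose x hx using hex
    obtain ⟨d, hd⟩ := exists_glue ht x fun Y Z f hf g => by
      obtain ⟨n, h, e⟩ := id hf
      rw [Category.comp_id] at e
      rw [hx f hf n h e, hx (g ≫ f) _ n (g ≫ h) (by rw [Category.assoc, e]), Category.assoc]
    refine ⟨d, fun n => ?_⟩
    have hn : coconeSieve t (𝟙 _) (t.ι.app n) := ⟨n, 𝟙 _, by simp⟩
    rw [hd _ hn, hx _ hn n (𝟙 _) (Category.id_comp _), Category.id_comp]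
  choose d hd using key
  exact ⟨{ desc := d
           fac := hd
           uniq := fun s m hm => hom_ext_of_cover ht fun Y f ⟨n, h, e⟩ => by
            rw [Category.comp_id] at e
            rw [← e, Category.assoc, Category.assoc, hm, hd] }⟩

/-- A compatible family on this sieve is determined by its values on the legs, and these values form
a cocone. -/
lemma isSheafFor_coconeSieve {J : Type*} [Category* J] {F : J ⥤ C} {t : Cocone F}
    (ht : IsColimit t) (W : C) :
    Presieve.IsSheafFor (yoneda.obj W) (coconeSieve t (𝟙 _)).arrows := by
  rw [isSheafFor_yoneda_iff]
  intro x hx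
  have hι (n : J) : coconeSieve t (𝟙 _) (t.ι.app n) := ⟨n, 𝟙 _, by simp⟩
  let s : Cocone F :=
    { pt := W
      ι :=
        { app := fun n => x _ (hι n)
          naturality := fun n m f => by
            refine (hx _ (hι m) (F.map f)).symm.trans (Eq.trans ?_ (Category.comp_id _).symm)
            congr 1
            exact t.w f } }
  refine ⟨ht.desc s, fun Y f hf => ?_, fun d hd => ht.hom_ext fun n => ?_⟩
  · obtain ⟨n, h, e⟩ := id hf
    rw [Category.comp_id] at e
    subst e
    rw [hx _ (hι n) h, Category.assoc, ht.fac]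
  · rw [ht.fac, hd _ (hι n)]

lemma isSheafFor_coconeSieve_inv {J : Type*} [Category* J] {F : J ⥤ C} {t : Cocone F}
    (ht : IsColimit t) {Z : C} (m : t.pt ⟶ Z) [IsIso m] (W : C) :
    Presieve.IsSheafFor (yoneda.obj W) (coconeSieve t (inv m)).arrows := by
  have h : coconeSieve t (inv m) = coconeSieve (t.extend m) (𝟙 Z) := by
    ext V g
    refine exists_congr fun n => exists_congr fun h => ?_
    rw [IsIso.eq_comp_inv, Category.assoc]
    exact Eq.congr rfl (Category.comp_id g).symm
  rw [h]
  exact isSheafFor_coconeSieve (IsColimit.ofIsoColimit ht (Cocone.extendIso t (asIso m))) W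

/-- The pullback of the sieve along `f` is the sieve of the pulled-back cocone, which universality
makes a colimit again. -/
lemma coconeSieve_mem_of_isUniversalColimit [HasPullbacks C] {J : Type*} [Category* J]
    {F : J ⥤ C} {t : Cocone F} (ht : IsUniversalColimit t) :
    coconeSieve t (𝟙 _) ∈ Sheaf.canonicalTopology C t.pt := by
  rw [mem_canonicalTopology_iff]
  intro Y f W
  let F' : J ⥤ C :=
    { obj := fun n => pullback f (t.ι.app n)
      map := fun {n m} k => pullback.lift (pullback.fst _ _) (pullback.snd _ _ ≫ F.map k)
        (by simp [pullback.condition])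
      map_id := fun n => by
        apply pullback.hom_ext <;> simp
      map_comp := fun k l => by
        apply pullback.hom_ext <;>
          simp [pullback.lift_fst, pullback.lift_snd, pullback.lift_snd_assoc] }
  let α : F' ⟶ F := { app := fun n => pullback.snd f (t.ι.app n)
                      naturality := fun _ _ _ => pullback.lift_snd _ _ _ }
  let t' : Cocone F' := { pt := Y
                          ι := { app := fun n => pullback.fst f (t.ι.app n)
                                 naturality := fun _ _ _ =>
                                  (pullback.lift_fst _ _ _).trans (Category.comp_id _).symm } }
  have hsq (n : J) : IsPullback (t'.ι.app n) (α.app n) f (t.ι.app n) := .of_hasPullback _ _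
  obtain ⟨ht'⟩ := ht t' α f (by ext n; exact (hsq n).w.symm) (fun n m k => by
    have := hsq n
    rw [← t.w k, ← t'.w k] at this
    exact IsPullback.of_right this (α.naturality k) (hsq m)) hsq
  convert isSheafFor_coconeSieve ht' W using 2
  rw [coconeSieve_pullback, Category.comp_id]
  ext V g
  constructor
  · rintro ⟨n, h, e⟩
    exact ⟨n, (hsq n).lift g h e.symm, ((hsq n).lift_fst _ _ _).trans (Category.comp_id _).symm⟩
  · rintro ⟨n, h, e⟩
    refine ⟨n, h ≫ α.app n, ?_⟩
    rw [Category.assoc, ← (hsq n).w, reassoc_of% e]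

variable {Z : C} (c : ℕ →o Subobject Z)

/-- The sieve of those morphisms `g` for which `g ≫ f` factors through some member of a chain of
subobjects. -/
def chainSieve {Y : C} (f : Y ⟶ Z) : Sieve Y where
  arrows _ g := ∃ n, (c n).Factors (g ≫ f)
  downward_closed := by
    rintro V V' g ⟨n, h⟩ k
    exact ⟨n, by rw [Category.assoc]; exact Subobject.factors_of_factors_right k h⟩

lemma chainSieve_pullback {Y Y' : C} (f : Y ⟶ Z) (g : Y' ⟶ Y) :
    (chainSieve c f).pullback g = chainSieve c (g ≫ f) := by
  ext V k
  simp [chainSieve]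

lemma chainSieve_pullbackChain [HasPullbacks C] {Y Y' : C} (f : Y ⟶ Z) (g : Y' ⟶ Y) :
    chainSieve (pullbackChain f c) g = chainSieve c (g ≫ f) := by
  ext V k
  exact exists_congr fun n => by
    rw [← Category.assoc]
    exact pullback_factors_iff f (c n) (k ≫ g)

variable {c}

variable (c) in
/-- The inclusion of a member of a chain of subobjects into the ambient object. -/
def chainLeg (n : ℕ) : (chainDiagram c).obj n ⟶ Z := (c n).arrow

instance (n : ℕ) : Mono (chainLeg c n) := inferInstanceAs (Mono (c n).arrow)

lemma chainLeg_w {n m : ℕ} (f : n ⟶ m) :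
    (chainDiagram c).map f ≫ chainLeg c m = chainLeg c n :=
  Subobject.underlying_arrow (c.monotone.functor.map f)

lemma factors_iff_chainLeg {V : C} (g : V ⟶ Z) (n : ℕ) :
    (c n).Factors g ↔ ∃ h : V ⟶ (chainDiagram c).obj n, h ≫ chainLeg c n = g :=
  ⟨fun h => ⟨(c n).factorThru g h, (c n).factorThru_arrow g h⟩, by
    rintro ⟨h, rfl⟩
    exact Subobject.factors_comp_arrow (P := c n) h⟩

/-- The inclusion of an upper bound of a chain of subobjects into the ambient object. -/
def boundLeg {U : Subobject Z} (hU : ∀ n, c n ≤ U) : (chainCocone c U hU).pt ⟶ Z := U.arrow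

instance {U : Subobject Z} (hU : ∀ n, c n ≤ U) : Mono (boundLeg hU) :=
  inferInstanceAs (Mono U.arrow)

lemma boundLeg_w {U : Subobject Z} (hU : ∀ n, c n ≤ U) (n : ℕ) :
    (chainCocone c U hU).ι.app n ≫ boundLeg hU = chainLeg c n :=
  Subobject.ofLE_arrow _

lemma coconeSieve_eq_chainSieve (t : Cocone (chainDiagram c)) (m : t.pt ⟶ Z) [Mono m]
    (hm : ∀ n, t.ι.app n ≫ m = chainLeg c n) {Y : C} (f : Y ⟶ t.pt) :
    coconeSieve t f = chainSieve c (f ≫ m) := by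
  ext V g
  refine exists_congr fun n => ?_
  rw [factors_iff_chainLeg]
  refine exists_congr fun h => ?_
  rw [← cancel_mono m, Category.assoc, hm, Category.assoc]

lemma mono_chain_leg (t : Cocone (chainDiagram c)) (m : t.pt ⟶ Z)
    (hm : ∀ n, t.ι.app n ≫ m = chainLeg c n) (n : ℕ) : Mono (t.ι.app n) := by
  have : Mono (t.ι.app n ≫ m) := by rw [hm]; infer_instance
  exact mono_of_mono _ m

/-- Both halves are gluing along the cover: of factorizations through another upper bound for the
join, and of morphisms for the colimit. -/
lemma isEffectiveUnion_of_chainSieve_mem {U : Subobject Z} (hU : ∀ n, c n ≤ U)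
    (h : chainSieve c U.arrow ∈ Sheaf.canonicalTopology C (U : C)) : IsEffectiveUnion c U where
  isLUB := by
    refine ⟨by rintro _ ⟨n, rfl⟩; exact hU n, fun V hV => Subobject.le_of_factors ?_⟩
    refine factors_of_cover h V _ fun T g ⟨n, hn⟩ => ?_
    exact Subobject.factors_of_le _ (hV ⟨n, rfl⟩) hn
  effective := by
    have := mono_chain_leg (chainCocone c U hU) (boundLeg hU) (boundLeg_w hU)
    refine nonempty_isColimit_of_coconeSieve_mem _ ?_
    rw [coconeSieve_eq_chainSieve _ (boundLeg hU) (boundLeg_w hU), Category.id_comp]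
    exact h

lemma isStableEffectiveUnion_of_chainSieve_mem [HasPullbacks C] {U : Subobject Z}
    (hU : ∀ n, c n ≤ U) (h : chainSieve c U.arrow ∈ Sheaf.canonicalTopology C (U : C)) :
    IsStableEffectiveUnion c U := by
  refine ⟨isEffectiveUnion_of_chainSieve_mem hU h, fun Y f => ?_⟩
  refine isEffectiveUnion_of_chainSieve_mem
    (fun n => (Subobject.pullback f).monotone (hU n)) ?_
  rw [chainSieve_pullbackChain, ← (Subobject.isPullback f U).w, ← chainSieve_pullback]
  exact (Sheaf.canonicalTopology C).pullback_stable _ h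

lemma IsEffectiveUnion.isSheafFor_of_isIso {U : Subobject Z} (h : IsEffectiveUnion c U)
    [IsIso U.arrow] (W : C) : Presieve.IsSheafFor (yoneda.obj W) (chainSieve c (𝟙 Z)).arrows := by
  obtain ⟨hlub, ⟨hc⟩⟩ := h
  have hU (n : ℕ) : c n ≤ U := hlub.1 (Set.mem_range_self n)
  have : IsIso (boundLeg hU) := inferInstanceAs (IsIso U.arrow)
  have ht := isSheafFor_coconeSieve_inv hc (boundLeg hU) W
  rwa [coconeSieve_eq_chainSieve _ (boundLeg hU) (boundLeg_w hU), IsIso.inv_hom_id] at ht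

/-- To test the sieve along `g : Y ⟶ U`, pull back along `g ≫ U.arrow`: there `U` becomes all of
`Y`, so the effective union of the pulled-back chain is the sheaf condition on `Y`. -/
lemma IsStableEffectiveUnion.chainSieve_mem [HasPullbacks C] {U : Subobject Z}
    (h : IsStableEffectiveUnion c U) :
    chainSieve c U.arrow ∈ Sheaf.canonicalTopology C (U : C) := by
  rw [mem_canonicalTopology_iff]
  intro Y g W
  rw [chainSieve_pullback]
  have hf : ((Subobject.pullback (g ≫ U.arrow)).obj U).Factors (𝟙 Y) := by
    rw [pullback_factors_iff, Category.id_comp]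
    exact Subobject.factors_comp_arrow g
  have : IsSplitEpi ((Subobject.pullback (g ≫ U.arrow)).obj U).arrow :=
    ⟨⟨⟨Subobject.factorThru _ _ hf, Subobject.factorThru_arrow _ _ _⟩⟩⟩
  have : IsIso ((Subobject.pullback (g ≫ U.arrow)).obj U).arrow :=
    isIso_of_mono_of_isSplitEpi _
  have ht := (h.2 (g ≫ U.arrow)).isSheafFor_of_isIso W
  rwa [chainSieve_pullbackChain, Category.id_comp] at ht

lemma hasStableColimit_of_chainSieve_mem {U : Subobject Z} (hU : ∀ n, c n ≤ U)
    (h : chainSieve c U.arrow ∈ Sheaf.canonicalTopology C (U : C)) : HasStableColimit c := by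
  refine ⟨chainCocone c U hU, (isEffectiveUnion_of_chainSieve_mem hU h).effective, ?_⟩
  have h' : coconeSieve (chainCocone c U hU) (𝟙 _) ∈ Sheaf.canonicalTopology C _ := by
    rw [coconeSieve_eq_chainSieve _ (boundLeg hU) (boundLeg_w hU), Category.id_comp]
    exact h
  intro F' t α f hα _ hsq
  have hmono (n : ℕ) : Mono ((chainCocone c U hU).ι.app n) :=
    mono_chain_leg _ (boundLeg hU) (boundLeg_w hU) n
  -- The legs stay monic under base change, so the cover criterion for colimits applies to the
  -- pulled-back cocone.
  have (n : ℕ) : Mono (t.ι.app n) :=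
    (MorphismProperty.monomorphisms C).of_isPullback (hsq n).flip (hmono n)
  refine nonempty_isColimit_of_coconeSieve_mem t ?_
  convert (Sheaf.canonicalTopology C).pullback_stable f h' using 1
  rw [coconeSieve_pullback, Category.comp_id]
  ext V g
  constructor
  · rintro ⟨n, k, e⟩
    rw [Category.comp_id] at e
    exact ⟨n, k ≫ α.app n, by rw [← e, Category.assoc, Category.assoc, (hsq n).w]⟩
  · rintro ⟨n, k, e⟩
    exact ⟨n, (hsq n).lift g k e.symm, by simp⟩

/-- The colimit is itself the required subobject: two maps into it that agree in `Z` factor locally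
through stages, and coincide at a common later stage because its leg to `Z` is monic. -/
lemma HasStableColimit.exists_chainSieve_mem [HasPullbacks C] (h : HasStableColimit c) :
    ∃ U : Subobject Z, (∀ n, c n ≤ U) ∧
      chainSieve c U.arrow ∈ Sheaf.canonicalTopology C (U : C) := by
  obtain ⟨t, ⟨ht⟩, hu⟩ := h
  have hcov := coconeSieve_mem_of_isUniversalColimit hu
  let s : Cocone (chainDiagram c) :=
    { pt := Z
      ι :=
        { app := chainLeg c
          naturality := fun n m f => (chainLeg_w f).trans (Category.comp_id _).symm } }
  obtain ⟨m, hm⟩ : ∃ m : t.pt ⟶ Z, ∀ n, t.ι.app n ≫ m = chainLeg c n :=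
    ⟨ht.desc s, ht.fac s⟩
  have : Mono m := by
    refine ⟨fun {V} a b hab => ?_⟩
    have ha := (Sheaf.canonicalTopology C).pullback_stable a hcov
    have hb := (Sheaf.canonicalTopology C).pullback_stable b hcov
    refine hom_ext_of_cover ((Sheaf.canonicalTopology C).intersection_covering ha hb) ?_
    rintro Y f ⟨⟨i, x, hx⟩, ⟨j, y, hy⟩⟩
    rw [Category.comp_id] at hx hy
    rw [← hx, ← hy]
    have hk : x ≫ (chainDiagram c).map (homOfLE (le_max_left i j)) =
        y ≫ (chainDiagram c).map (homOfLE (le_max_right i j)) := by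
      rw [← cancel_mono (chainLeg c (max i j)), Category.assoc, Category.assoc, chainLeg_w,
        chainLeg_w, ← hm, ← hm, reassoc_of% hx, reassoc_of% hy, hab]
    rw [← t.w (homOfLE (le_max_left i j)), reassoc_of% hk, t.w]
  refine ⟨Subobject.mk m, fun n => ?_, ?_⟩
  · exact Subobject.le_of_factors ((Subobject.mk_factors_iff _ _).2 ⟨t.ι.app n, hm n⟩)
  · have h1 := coconeSieve_eq_chainSieve t m hm (Subobject.underlyingIso m).hom
    rw [Subobject.underlyingIso_hom_comp_eq_mk] at h1
    rw [← h1, ← Category.comp_id (Subobject.underlyingIso m).hom, ← coconeSieve_pullback]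
    exact (Sheaf.canonicalTopology C).pullback_stable _ hcov

end Chains

/-! ### Generalized elements of relations in regular categories -/

section Holds

variable {C : Type u} [Category.{w} C] [HasBinaryProducts C] {X Y : C}

/-- The generalized elements `a` and `b` are related by the relation `R`. -/
abbrev Holds (R : Subobject (X ⨯ Y)) {T : C} (a : T ⟶ X) (b : T ⟶ Y) : Prop :=
  R.Factors (prod.lift a b)

variable {R : Subobject (X ⨯ Y)} {T T' : C} {a : T ⟶ X} {b : T ⟶ Y}

lemma Holds.comp (h : Holds R a b) (g : T' ⟶ T) : Holds R (g ≫ a) (g ≫ b) := by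
  rw [Holds, ← prod.comp_lift]
  exact Subobject.factors_of_factors_right g h

lemma holds_iff_exists :
    Holds R a b ↔ ∃ l : T ⟶ (R : C), l ≫ R.arrow ≫ prod.fst = a ∧ l ≫ R.arrow ≫ prod.snd = b := by
  constructor
  · intro h
    refine ⟨R.factorThru _ h, ?_, ?_⟩
    · rw [← Category.assoc, Subobject.factorThru_arrow, prod.lift_fst]
    · rw [← Category.assoc, Subobject.factorThru_arrow, prod.lift_snd]
  · rintro ⟨l, rfl, rfl⟩
    have : prod.lift (l ≫ R.arrow ≫ prod.fst) (l ≫ R.arrow ≫ prod.snd) = l ≫ R.arrow := by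
      apply prod.hom_ext
      · rw [prod.lift_fst, Category.assoc]
      · rw [prod.lift_snd, Category.assoc]
    rw [Holds, this]
    exact Subobject.factors_comp_arrow l

/-- The sieve on which two generalized elements are related by the equivalence relation generated
by `R`. -/
def eqvSieve (R : Subobject (X ⨯ X)) {T : C} (a b : T ⟶ X) : Sieve T where
  arrows V g := Relation.EqvGen (Holds R) (g ≫ a) (g ≫ b)
  downward_closed := by
    intro V V' g h k
    have key {x y : V ⟶ X} (h : Relation.EqvGen (Holds R) x y) :
        Relation.EqvGen (Holds R) (k ≫ x) (k ≫ y) := by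
      induction h with
      | rel x y h => exact .rel _ _ (h.comp k)
      | refl x => exact .refl _
      | symm x y _ ih => exact .symm _ _ ih
      | trans x y z _ _ ih ih' => exact .trans _ _ _ ih ih'
    rw [Category.assoc, Category.assoc]
    exact key h

lemma eqvSieve_pullback (R : Subobject (X ⨯ X)) {T T' : C} (a b : T ⟶ X) (g : T' ⟶ T) :
    (eqvSieve R a b).pullback g = eqvSieve R (g ≫ a) (g ≫ b) := by
  ext V k
  simp [eqvSieve]

end Holds

/-! ### Images, composites of relations and generated equivalence relations, read locally. -/

section Regular

variable {C : Type u} [Category.{w} C] [Regular C] {X Y Z : C}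

lemma IsReflexiveRel.holds {R : Subobject (X ⨯ X)} (hR : IsReflexiveRel R) {T : C} (a : T ⟶ X) :
    Holds R a a := by
  have : prod.lift a a = a ≫ diag X := by
    rw [diag, prod.comp_lift, Category.comp_id]
  rw [Holds, this]
  exact Subobject.factors_of_factors_right a hR

/-- The regular topology is subcanonical, hence coarser than the canonical one. -/
lemma mem_canonicalTopology_of_isRegularEpi {e : X ⟶ Y} [IsRegularEpi e] {S : Sieve Y}
    (h : S e) : S ∈ Sheaf.canonicalTopology C Y := by
  refine Sheaf.le_finestTopology _ (regularTopology C) ?_ _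
    ((regularTopology.mem_sieves_iff_hasEffectiveEpi S).2 ⟨X, e, inferInstance, h⟩)
  rintro _ ⟨W, rfl⟩
  exact regularTopology.isSheaf_yoneda_obj W

lemma isRegularEpi_factorThruImageSubobject (f : X ⟶ Y) :
    IsRegularEpi (factorThruImageSubobject f) := by
  have : StrongEpi (factorThruImageSubobject f) :=
    inferInstanceAs (StrongEpi (factorThruImage f ≫ (imageSubobjectIso f).inv))
  infer_instance

/-- Membership in an image means local liftability; this allows relational composites to be computed
with generalized elements, the intermediate element existing only on a cover. -/
lemma imageSubobject_factors_iff (f : X ⟶ Y) {T : C} (t : T ⟶ Y) :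
    (imageSubobject f).Factors t ↔
      (Sieve.generateSingleton f).pullback t ∈ Sheaf.canonicalTopology C T := by
  constructor
  · intro h
    have := isRegularEpi_factorThruImageSubobject f
    have hc := (Sheaf.canonicalTopology C).pullback_stable ((imageSubobject f).factorThru t h)
      (mem_canonicalTopology_of_isRegularEpi (e := factorThruImageSubobject f)
        (S := Sieve.generateSingleton (factorThruImageSubobject f)) ⟨𝟙 _, Category.id_comp _⟩)
    refine (Sheaf.canonicalTopology C).superset_covering ?_ hc
    rintro V g ⟨l, hl⟩
    refine ⟨l, ?_⟩
    rw [← imageSubobject_arrow_comp f, ← Category.assoc, hl, Category.assoc,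
      Subobject.factorThru_arrow]
  · intro h
    refine factors_of_cover h _ _ fun V g ⟨l, hl⟩ => ?_
    rw [← hl]
    exact imageSubobject_factors_comp_self f l

lemma holds_relOp {R : Subobject (X ⨯ Y)} {T : C} {a : T ⟶ Y} {b : T ⟶ X} :
    Holds (relOp R) a b ↔ Holds R b a := by
  rw [Holds, relOp, pullback_factors_iff, Holds]
  have : prod.lift a b ≫ (prod.braiding Y X).hom = prod.lift b a := by
    apply prod.hom_ext <;> simp [prod.lift_fst, prod.lift_snd]
  rw [this]

lemma holds_relComp_of_holds {R : Subobject (X ⨯ Y)} {S : Subobject (Y ⨯ Z)} {T : C}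
    {a : T ⟶ X} {y : T ⟶ Y} {b : T ⟶ Z} (h : Holds R a y) (h' : Holds S y b) :
    Holds (relComp R S) a b := by
  obtain ⟨l, rfl, rfl⟩ := holds_iff_exists.1 h
  obtain ⟨l', hl', rfl⟩ := holds_iff_exists.1 h'
  rw [Holds, relComp]
  have : prod.lift (l ≫ R.arrow ≫ prod.fst) (l' ≫ S.arrow ≫ prod.snd) =
      pullback.lift l l' hl'.symm ≫ prod.lift
        (pullback.fst (R.arrow ≫ prod.snd) (S.arrow ≫ prod.fst) ≫ R.arrow ≫ prod.fst)
        (pullback.snd (R.arrow ≫ prod.snd) (S.arrow ≫ prod.fst) ≫ S.arrow ≫ prod.snd) := by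
    rw [prod.comp_lift, pullback.lift_fst_assoc, pullback.lift_snd_assoc]
  rw [this]
  exact imageSubobject_factors_comp_self _ _

lemma exists_cover_of_holds_relComp {R : Subobject (X ⨯ Y)} {S : Subobject (Y ⨯ Z)} {T : C}
    {a : T ⟶ X} {b : T ⟶ Z} (h : Holds (relComp R S) a b) :
    ∃ U ∈ Sheaf.canonicalTopology C T, ∀ ⦃V : C⦄ (g : V ⟶ T), U g →
      ∃ y : V ⟶ Y, Holds R (g ≫ a) y ∧ Holds S y (g ≫ b) := by
  refine ⟨_, (imageSubobject_factors_iff _ _).1 h, ?_⟩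
  rintro V g ⟨l, hl⟩
  rw [prod.comp_lift, prod.comp_lift] at hl
  have h₁ := congrArg (· ≫ prod.fst) hl
  have h₂ := congrArg (· ≫ prod.snd) hl
  simp only [prod.lift_fst, prod.lift_snd] at h₁ h₂
  refine ⟨l ≫ pullback.fst _ _ ≫ R.arrow ≫ prod.snd, holds_iff_exists.2
    ⟨l ≫ pullback.fst _ _, by rw [Category.assoc, h₁], by rw [Category.assoc]⟩,
    holds_iff_exists.2 ⟨l ≫ pullback.snd _ _, ?_, by rw [Category.assoc, h₂]⟩⟩
  rw [Category.assoc, ← pullback.condition]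

lemma eqvSieve_mem_of_holds_relChainAux {R : Subobject (X ⨯ X)} (n : ℕ) :
    ∀ {T : C} {a b : T ⟶ X}, Holds (relChainAux R n) a b →
      eqvSieve R a b ∈ Sheaf.canonicalTopology C T := by
  induction n with
  | zero =>
    intro T a b h
    exact (Sheaf.canonicalTopology C).superset_covering
      (fun V g _ => .rel _ _ (Holds.comp h g)) ((Sheaf.canonicalTopology C).top_mem T)
  | succ n ih =>
    intro T a b h
    obtain ⟨U, hU, h⟩ := exists_cover_of_holds_relComp h
    refine (Sheaf.canonicalTopology C).transitive hU _ fun V g hg => ?_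
    obtain ⟨y, h₁, h₂⟩ := h g hg
    -- One link of the chain is two composites, so a second refinement is needed to find the other
    -- intermediate element.
    obtain ⟨U', hU', h₁⟩ := exists_cover_of_holds_relComp h₁
    rw [eqvSieve_pullback]
    refine (Sheaf.canonicalTopology C).transitive hU' _ fun V' g' hg' => ?_
    obtain ⟨z, h₃, h₄⟩ := h₁ g' hg'
    rw [eqvSieve_pullback]
    refine (Sheaf.canonicalTopology C).superset_covering ?_ (ih h₃)
    intro V'' k hk
    have hz : Relation.EqvGen (Holds R) (k ≫ g' ≫ y) (k ≫ z) :=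
      .rel _ _ ((holds_relOp.1 h₄).comp k)
    have hb : Relation.EqvGen (Holds R) (k ≫ g' ≫ y) (k ≫ g' ≫ g ≫ b) :=
      .rel _ _ ((h₂.comp g').comp k)
    exact .trans _ _ _ hk (.trans _ _ _ (.symm _ _ hz) hb)

lemma exists_holds_relChainAux {R : Subobject (X ⨯ X)} (hR : IsReflexiveRel R) {T : C}
    {a b : T ⟶ X} (h : Relation.EqvGen (Holds R) a b) : ∃ n, Holds (relChainAux R n) a b := by
  rw [← Relation.EqvGen.reflTransGen_symmGen] at h
  induction h with
  | refl => exact ⟨0, hR.holds a⟩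
  | tail _ h ih =>
    obtain ⟨n, hn⟩ := ih
    refine ⟨n + 1, ?_⟩
    -- Each step of a zigzag, forward or backward, uses up one whole factor `R° R`; reflexivity
    -- fills the unused half.
    rcases h with h | h
    · exact holds_relComp_of_holds (holds_relComp_of_holds hn (hR.op.holds _)) h
    · exact holds_relComp_of_holds (holds_relComp_of_holds hn (holds_relOp.2 h)) (hR.holds _)

lemma chainSieve_relChain_mem_iff {R : Subobject (X ⨯ X)} (hR : IsReflexiveRel R) {T : C}
    {a b : T ⟶ X} :
    chainSieve (relChain R hR) (prod.lift a b) ∈ Sheaf.canonicalTopology C T ↔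
      eqvSieve R a b ∈ Sheaf.canonicalTopology C T := by
  constructor
  · intro h
    refine (Sheaf.canonicalTopology C).transitive h _ fun V g ⟨n, hn⟩ => ?_
    rw [eqvSieve_pullback]
    rw [prod.comp_lift] at hn
    exact eqvSieve_mem_of_holds_relChainAux n hn
  · refine (Sheaf.canonicalTopology C).superset_covering fun V g h => ?_
    obtain ⟨n, hn⟩ := exists_holds_relChainAux hR h
    exact ⟨n, by rw [prod.comp_lift]; exact hn⟩

/-- If a bound `U` of the chain `R, R R° R, …` is canonically covered by the chain, then it is
locally the equivalence relation generated by `R`. -/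
lemma holds_iff_eqvSieve_mem {R : Subobject (X ⨯ X)} (hR : IsReflexiveRel R)
    {U : Subobject (X ⨯ X)} (hU : ∀ n, relChain R hR n ≤ U)
    (hc : chainSieve (relChain R hR) U.arrow ∈ Sheaf.canonicalTopology C (U : C)) {T : C}
    {a b : T ⟶ X} : Holds U a b ↔ eqvSieve R a b ∈ Sheaf.canonicalTopology C T := by
  rw [← chainSieve_relChain_mem_iff hR]
  constructor
  · intro h
    have := (Sheaf.canonicalTopology C).pullback_stable (U.factorThru _ h) hc
    rwa [chainSieve_pullback, Subobject.factorThru_arrow] at this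
  · exact fun h => factors_of_cover h U _ fun V g ⟨n, hn⟩ => Subobject.factors_of_le _ (hU n) hn

end Regular

/-! ### Internal equivalence relations from generalized elements -/

section Equivalence

variable {C : Type u} [Category.{w} C] [HasFiniteLimits C] {X : C}

/-- Yoneda: the structure maps come from the three laws at generic elements, namely the identity of
`X`, the two projections of `U`, and the generic composable pair. -/
lemma isEquivalenceRelation_of_holds {U : Subobject (X ⨯ X)}
    (hU : ∀ T : C, Equivalence (Holds U (T := T))) :
    IsEquivalenceRelation (U.arrow ≫ prod.fst) (U.arrow ≫ prod.snd) := by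
  have hgen : Holds U (U.arrow ≫ prod.fst) (U.arrow ≫ prod.snd) :=
    holds_iff_exists.2 ⟨𝟙 _, Category.id_comp _, Category.id_comp _⟩
  have hr := holds_iff_exists.1 ((hU _).refl (𝟙 X))
  have hs := holds_iff_exists.1 ((hU _).symm hgen)
  have h₁ := hgen.comp (pullback.fst (U.arrow ≫ prod.snd) (U.arrow ≫ prod.fst))
  have h₂ := hgen.comp (pullback.snd (U.arrow ≫ prod.snd) (U.arrow ≫ prod.fst))
  rw [pullback.condition] at h₁
  have ht := holds_iff_exists.1 ((hU _).trans h₁ h₂)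
  exact
    { nonempty_equivalenceRelation :=
        ⟨{ right_cancellation := fun T f g h h' => by
            rw [← cancel_mono U.arrow]
            apply prod.hom_ext
            · simpa using h
            · simpa using h'
           r := hr.choose
           reflexivity₁ := hr.choose_spec.1
           reflexivity₂ := hr.choose_spec.2
           s := hs.choose
           symmetry₁ := hs.choose_spec.1
           symmetry₂ := hs.choose_spec.2
           c := pullback.cone _ _
           isLimit := pullback.isLimit _ _
           t := ht.choose
           transitivity₁ := ht.choose_spec.1
           transitivity₂ := ht.choose_spec.2 }⟩ }

lemma equivalence_of_holds_iff {R U : Subobject (X ⨯ X)}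
    (h : ∀ ⦃T : C⦄ (a b : T ⟶ X), Holds U a b ↔ eqvSieve R a b ∈ Sheaf.canonicalTopology C T)
    (T : C) : Equivalence (Holds U (T := T)) where
  refl a := (h a a).2 <| (Sheaf.canonicalTopology C).superset_covering
    (fun _ _ _ => .refl _) ((Sheaf.canonicalTopology C).top_mem T)
  symm {a b} hab := (h b a).2 <| (Sheaf.canonicalTopology C).superset_covering
    (fun _ _ hg => .symm _ _ hg) ((h a b).1 hab)
  trans {a b c} hab hbc := (h a c).2 <| (Sheaf.canonicalTopology C).superset_covering
    (S := eqvSieve R a b ⊓ eqvSieve R b c) (fun _ _ hg => .trans _ _ _ hg.1 hg.2)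
    ((Sheaf.canonicalTopology C).intersection_covering ((h a b).1 hab) ((h b c).1 hbc))

end Equivalence

/-! ### Coequalizers of presheaves -/

section PresheafCoequalizer

lemma types_coequalizer_surjective {X Y Z : Type w} {f g : X ⟶ Y} {π : Y ⟶ Z}
    {e : f ≫ π = g ≫ π} (h : IsColimit (Cofork.ofπ π e)) : Function.Surjective π := by
  have : Epi π := epi_of_isColimit_cofork h
  exact (epi_iff_surjective π).1 this

lemma types_coequalizer_eqvGen {X Y Z : Type w} {f g : X ⟶ Y} {π : Y ⟶ Z}
    {e : f ≫ π = g ≫ π} (h : IsColimit (Cofork.ofπ π e)) {x y : Y} (hxy : π x = π y) :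
    Relation.EqvGen (fun x y => ∃ z, f z = x ∧ g z = y) x y := by
  let r : Y → Y → Prop := fun x y => ∃ z, f z = x ∧ g z = y
  let q : Y ⟶ Quot r := TypeCat.ofHom (Quot.mk r)
  have hq : f ≫ q = g ≫ q := by
    ext z
    exact Quot.sound ⟨z, rfl, rfl⟩
  obtain ⟨d, hd⟩ := Cofork.IsColimit.desc' h q hq
  have hd' (y : Y) : d (π y) = Quot.mk r y := ConcreteCategory.congr_hom hd y
  exact Quot.eqvGen_exact (by rw [← hd', ← hd', hxy])

variable {K : Type*} [Category* K] {F G H : K ⥤ Type w} {a b : F ⟶ G} {π : G ⟶ H}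
  {e : a ≫ π = b ≫ π}

lemma presheaf_coequalizer_surjective (h : IsColimit (Cofork.ofπ π e)) (k : K) :
    Function.Surjective (π.app k) :=
  types_coequalizer_surjective (isColimitCoforkMapOfIsColimit ((evaluation _ _).obj k) e h)

lemma presheaf_coequalizer_eqvGen (h : IsColimit (Cofork.ofπ π e)) (k : K) {x y : G.obj k}
    (hxy : π.app k x = π.app k y) :
    Relation.EqvGen (fun x y => ∃ z, a.app k z = x ∧ b.app k z = y) x y :=
  types_coequalizer_eqvGen (isColimitCoforkMapOfIsColimit ((evaluation _ _).obj k) e h) hxy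

end PresheafCoequalizer

/-! ### Colimits weighted by a coequalizer of representables -/

section Weighted

variable {K : Type*} [Category* K] {E : Type*} [Category* E] {W : Kᵒᵖ ⥤ Type w} {D : K ⥤ E}

/-- The component of a cocone under a weighted diagram at an element of the weight. -/
def weightedLeg (c : Cocone (weightedDiagram W D)) (k : K) (x : W.obj (op k)) :
    D.obj k ⟶ c.pt :=
  c.ι.app (op ⟨op k, x⟩)

lemma weightedLeg_naturality (c : Cocone (weightedDiagram W D)) {k k' : K} (f : k' ⟶ k)
    (x : W.obj (op k)) :
    D.map f ≫ weightedLeg c k x = weightedLeg c k' (W.map f.op x) :=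
  c.w (Quiver.Hom.op (CategoryOfElements.homMk (F := W) ⟨op k, x⟩ ⟨op k', W.map f.op x⟩ f.op rfl))

/-- A cocone under a weighted diagram, from its components at the elements of the weight. -/
def weightedCocone (Z : E) (leg : ∀ (k : K), W.obj (op k) → (D.obj k ⟶ Z))
    (hleg : ∀ ⦃k k' : K⦄ (f : k' ⟶ k) (x : W.obj (op k)),
      D.map f ≫ leg k x = leg k' (W.map f.op x)) : Cocone (weightedDiagram W D) where
  pt := Z
  ι :=
    { app := fun p => leg p.unop.1.unop p.unop.2
      naturality := fun p q f => by
        refine Eq.trans ?_ (Category.comp_id _).symm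
        refine (hleg f.unop.val.unop q.unop.2).trans ?_
        exact congrArg (leg p.unop.1.unop) f.unop.2 }

end Weighted

section WeightedCoequalizer

variable {K : Type*} [Category.{w} K] {E : Type*} [Category* E] {W : Kᵒᵖ ⥤ Type w} {D : K ⥤ E}
  {X Y : K} {d c : X ⟶ Y} {π : yoneda.obj Y ⟶ W} {e : yoneda.map d ≫ π = yoneda.map c ≫ π}

lemma map_comp_eq_of_coequalizer (h : IsColimit (Cofork.ofπ π e)) {Z : E} (f : D.obj Y ⟶ Z)
    (hf : D.map d ≫ f = D.map c ≫ f) {k : K} {u v : k ⟶ Y}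
    (huv : π.app (op k) u = π.app (op k) v) : D.map u ≫ f = D.map v ≫ f := by
  have := presheaf_coequalizer_eqvGen h (op k) huv
  clear huv
  induction this with
  | rel u v h =>
    obtain ⟨z, rfl, rfl⟩ := h
    change D.map (z ≫ d) ≫ f = D.map (z ≫ c) ≫ f
    rw [D.map_comp, D.map_comp, Category.assoc, Category.assoc, hf]
  | refl u => rfl
  | symm u v _ ih => exact ih.symm
  | trans u v t _ _ ih ih' => exact ih.trans ih'

/-- The class of `𝟙 Y` is a universal element: when `π` is a coequaliser, hence surjective, the leg
at this class determines all the others. -/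
lemma map_comp_weightedLeg (s : Cocone (weightedDiagram W D)) {k : K} (u : k ⟶ Y) :
    D.map u ≫ weightedLeg s Y (π.app (op Y) (𝟙 Y)) = weightedLeg s k (π.app (op k) u) := by
  rw [weightedLeg_naturality]
  congr 1
  have := π.naturality_apply u.op (𝟙 Y)
  simpa using this.symm

/-- A cocone under the diagram weighted by a coequalizer of representables, from a morphism
coequalizing the corresponding pair. -/
lemma exists_weightedCocone (h : IsColimit (Cofork.ofπ π e)) {Z : E} (f : D.obj Y ⟶ Z)
    (hf : D.map d ≫ f = D.map c ≫ f) :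
    ∃ leg : ∀ (k : K), W.obj (op k) → (D.obj k ⟶ Z),
      (∀ ⦃k k' : K⦄ (g : k' ⟶ k) (x : W.obj (op k)),
        D.map g ≫ leg k x = leg k' (W.map g.op x)) ∧
      ∀ ⦃k : K⦄ (u : k ⟶ Y), leg k (π.app (op k) u) = D.map u ≫ f := by
  choose l hl using fun k => presheaf_coequalizer_surjective h (op k)
  have hleg (k : K) (u : k ⟶ Y) : D.map (l k (π.app (op k) u) : k ⟶ Y) ≫ f = D.map u ≫ f :=
    map_comp_eq_of_coequalizer h f hf (hl k _)
  refine ⟨fun k x => D.map (l k x : k ⟶ Y) ≫ f, fun k k' g x => ?_, hleg⟩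
  obtain ⟨u, rfl⟩ := presheaf_coequalizer_surjective h (op k) x
  have hu : W.map g.op (π.app (op k) u) = π.app (op k') (g ≫ u : k' ⟶ Y) :=
    (π.naturality_apply g.op u).symm
  rw [hu]
  refine Eq.trans ?_ (hleg k' (g ≫ u)).symm
  rw [D.map_comp, Category.assoc]
  exact congrArg _ (hleg k u)

lemma weighted_ext (h : IsColimit (Cofork.ofπ π e)) {s : Cocone (weightedDiagram W D)}
    (hs : IsColimit s) {Z : E} {f g : s.pt ⟶ Z}
    (hfg : weightedLeg s Y (π.app (op Y) (𝟙 Y)) ≫ f = weightedLeg s Y (π.app (op Y) (𝟙 Y)) ≫ g) :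
    f = g := by
  refine hs.hom_ext fun p => ?_
  obtain ⟨⟨⟨k⟩, x⟩⟩ := p
  obtain ⟨u, rfl⟩ := presheaf_coequalizer_surjective h (op k) x
  have hu := map_comp_weightedLeg (π := π) s (u : k ⟶ Y)
  change weightedLeg s k (π.app (op k) u) ≫ f = weightedLeg s k (π.app (op k) u) ≫ g
  rw [← hu, Category.assoc, Category.assoc, hfg]

lemma map_comp_weightedLeg_eq (e : yoneda.map d ≫ π = yoneda.map c ≫ π)
    (s : Cocone (weightedDiagram W D)) :
    D.map d ≫ weightedLeg s Y (π.app (op Y) (𝟙 Y)) =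
      D.map c ≫ weightedLeg s Y (π.app (op Y) (𝟙 Y)) := by
  rw [map_comp_weightedLeg, map_comp_weightedLeg]
  congr 1
  have := ConcreteCategory.congr_hom (NatTrans.congr_app e (op X)) (𝟙 X)
  simpa using this

/-- The colimit weighted by a coequalizer of representables is a coequalizer. -/
def isColimitOfWeighted (h : IsColimit (Cofork.ofπ π e)) {s : Cocone (weightedDiagram W D)}
    (hs : IsColimit s) :
    IsColimit (Cofork.ofπ (weightedLeg s Y (π.app (op Y) (𝟙 Y)))
      (map_comp_weightedLeg_eq e s)) :=
  Cofork.IsColimit.ofExistsUnique fun t => by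
    obtain ⟨leg, hleg, hl⟩ := exists_weightedCocone (D := D) h t.π t.condition
    refine ⟨hs.desc (weightedCocone t.pt leg hleg), ?_, fun m hm => weighted_ext h hs ?_⟩
    · exact (hs.fac (weightedCocone t.pt leg hleg) _).trans ((hl (𝟙 Y)).trans (by simp))
    · refine Eq.trans hm (Eq.symm ?_)
      exact (hs.fac (weightedCocone t.pt leg hleg) _).trans ((hl (𝟙 Y)).trans (by simp))

/-- The coequalizer of a pair of morphisms is the corresponding weighted colimit. -/
lemma exists_weighted_isColimit (h : IsColimit (Cofork.ofπ π e)) {t : Cofork (D.map d) (D.map c)}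
    (ht : IsColimit t) :
    ∃ s : Cocone (weightedDiagram W D), s.pt = t.pt ∧ Nonempty (IsColimit s) := by
  obtain ⟨leg, hleg, hl⟩ := exists_weightedCocone (D := D) h t.π t.condition
  refine ⟨weightedCocone t.pt leg hleg, rfl, ⟨?_⟩⟩
  have key (s : Cocone (weightedDiagram W D)) :
      ∃ m : t.pt ⟶ s.pt, t.π ≫ m = weightedLeg s Y (π.app (op Y) (𝟙 Y)) := by
    obtain ⟨m, hm⟩ := Cofork.IsColimit.desc' ht _ (map_comp_weightedLeg_eq e s)
    exact ⟨m, hm⟩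
  choose m hm using key
  exact
    { desc := m
      fac := fun s p => by
        obtain ⟨⟨⟨k⟩, x⟩⟩ := p
        obtain ⟨u, rfl⟩ := presheaf_coequalizer_surjective h (op k) x
        change leg k (π.app (op k) u) ≫ m s = weightedLeg s k (π.app (op k) u)
        refine Eq.trans ?_ (map_comp_weightedLeg s u)
        rw [← hm]
        exact (congrArg (· ≫ m s) (hl (u : k ⟶ Y))).trans (Category.assoc _ _ _)
      uniq := fun s n hn => by
        refine Cofork.IsColimit.hom_ext ht ?_
        rw [hm]
        refine Eq.trans ?_ (hn (op ⟨op Y, π.app (op Y) (𝟙 Y)⟩))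
        refine congrArg (· ≫ n) (Eq.symm ?_)
        exact (hl (𝟙 Y)).trans (by simp) }

end WeightedCoequalizer

/-! ### Reflexive coequalizers from covers by chains -/

section Sheaves

variable {C : Type u} [Category.{w} C] [Regular C] {X Y : C}

/-- Sections of a sheaf coequalized by `d` and `c` agree on generalized elements which are locally
identified by the equivalence relation generated by `d` and `c`. -/
lemma map_eq_of_eqvSieve_mem {F : Cᵒᵖ ⥤ Type*}
    (hF : Presieve.IsSheaf (Sheaf.canonicalTopology C) F) {d c : X ⟶ Y} {s : F.obj (op Y)}
    (hs : F.map d.op s = F.map c.op s) {T : C} {a b : T ⟶ Y}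
    (h : eqvSieve (imageSubobject (prod.lift d c)) a b ∈ Sheaf.canonicalTopology C T) :
    F.map a.op s = F.map b.op s := by
  have hgen {V : C} {x y : V ⟶ Y} (h : Holds (imageSubobject (prod.lift d c)) x y) :
      F.map x.op s = F.map y.op s := by
    refine (hF _ ((imageSubobject_factors_iff _ _).1 h)).isSeparatedFor.ext ?_
    rintro U g ⟨l, hl⟩
    rw [prod.comp_lift, prod.comp_lift] at hl
    have h₁ : l ≫ d = g ≫ x := by simpa [prod.lift_fst] using congrArg (· ≫ prod.fst) hl
    have h₂ : l ≫ c = g ≫ y := by simpa [prod.lift_snd] using congrArg (· ≫ prod.snd) hl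
    simp only [← Functor.map_comp_apply, ← op_comp, ← h₁, ← h₂]
    simp only [op_comp, Functor.map_comp_apply, hs]
  refine (hF _ h).isSeparatedFor.ext fun V g hg => ?_
  simp only [← Functor.map_comp_apply, ← op_comp]
  have hg' : Relation.EqvGen (Holds (imageSubobject (prod.lift d c))) (g ≫ a) (g ≫ b) := hg
  clear hg
  generalize g ≫ a = x, g ≫ b = y at hg'
  induction hg' with
  | rel x y h => exact hgen h
  | refl x => rfl
  | symm x y _ ih => exact ih.symm
  | trans x y z _ _ ih ih' => exact ih.trans ih'

lemma isReflexiveRel_image {d c : X ⟶ Y} (r : Y ⟶ X) (hd : r ≫ d = 𝟙 Y) (hc : r ≫ c = 𝟙 Y) :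
    IsReflexiveRel (imageSubobject (prod.lift d c)) := by
  have : diag Y = r ≫ prod.lift d c := by rw [prod.comp_lift, hd, hc]
  rw [IsReflexiveRel, this]
  exact imageSubobject_factors_comp_self _ _

end Sheaves

/-! ### Quotients of reflexive pairs in Barr-exact categories whose chains cover. -/

section Exact

variable {C : Type u} [Category.{w} C] [BarrExact C]

/-- The condition that each chain `R, R R° R, …` generated by a reflexive relation canonically
covers some upper bound. -/
def ChainsCover (C : Type u) [Category.{w} C] [Regular C] : Prop :=
  ∀ (X : C) (R : Subobject (X ⨯ X)) (hR : IsReflexiveRel R),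
    ∃ U : Subobject (X ⨯ X), (∀ n, relChain R hR n ≤ U) ∧
      chainSieve (relChain R hR) U.arrow ∈ Sheaf.canonicalTopology C (U : C)

/-- In a Barr-exact category, an effective equivalence relation has a regular epimorphic
quotient. -/
lemma exists_regularEpi_of_equivalence {X : C} {U : Subobject (X ⨯ X)}
    (hU : ∀ T : C, Equivalence (Holds U (T := T))) :
    ∃ (Z : C) (q : X ⟶ Z), IsRegularEpi q ∧
      ∀ ⦃T : C⦄ (a b : T ⟶ X), a ≫ q = b ≫ q ↔ Holds U a b := by
  obtain ⟨Y, p, hp⟩ := BarrExact.exists_isKernelPair _ _ (isEquivalenceRelation_of_holds hU)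
  -- Effectivity only provides some `p` with kernel pair `U`; its image part has the same kernel
  -- pair, since `F.m` is monic.
  let F := Regular.strongEpiMonoFactorisation p
  refine ⟨F.I, F.e, inferInstance, fun T a b => ?_⟩
  rw [← cancel_mono F.m, Category.assoc, Category.assoc, F.fac, holds_iff_exists]
  constructor
  · intro h
    exact ⟨hp.lift a b h, hp.lift_fst _ _ h, hp.lift_snd _ _ h⟩
  · rintro ⟨l, rfl, rfl⟩
    have := hp.w
    simp only [Category.assoc] at this ⊢
    rw [this]

/-- Here `q` is the quotient by the equivalence relation that the image of `(d, c)` generates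
locally. A section of a sheaf equalised by `d` and `c` is equalised by that relation too, so it
descends along the cover `q`. Allowing all sheaves, not only representables, is what makes `q` a
coequaliser of sheaves. -/
lemma exists_quotient (hC : ChainsCover C) {X Y : C} {d c : X ⟶ Y} (r : Y ⟶ X)
    (hd : r ≫ d = 𝟙 Y) (hc : r ≫ c = 𝟙 Y) :
    ∃ (Z : C) (q : Y ⟶ Z), d ≫ q = c ≫ q ∧
      ∀ (F : Cᵒᵖ ⥤ Type (max w u)), Presieve.IsSheaf (Sheaf.canonicalTopology C) F →
        ∀ s : F.obj (op Y), F.map d.op s = F.map c.op s → ∃! t, F.map q.op t = s := by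
  have hR := isReflexiveRel_image r hd hc
  obtain ⟨U, hU, hcov⟩ := hC Y _ hR
  have hiff ⦃T : C⦄ (a b : T ⟶ Y) := holds_iff_eqvSieve_mem hR hU hcov (a := a) (b := b)
  obtain ⟨Z, q, hq, hqU⟩ := exists_regularEpi_of_equivalence (equivalence_of_holds_iff hiff)
  refine ⟨Z, q, ?_, fun F hF s hs => ?_⟩
  · rw [hqU, hiff]
    refine (Sheaf.canonicalTopology C).superset_covering (S := ⊤) (fun V g _ => .rel _ _ ?_)
      ((Sheaf.canonicalTopology C).top_mem X)
    rw [Holds, ← prod.comp_lift]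
    exact imageSubobject_factors_comp_self _ _
  · have hS : Presieve.IsSheafFor F (Presieve.singleton q) := by
      rw [Presieve.isSheafFor_iff_generate]
      exact hF _ (mem_canonicalTopology_of_isRegularEpi (e := q)
        ⟨Y, 𝟙 _, q, Presieve.singleton_self q, Category.id_comp _⟩)
    refine Presieve.isSheafFor_singleton.1 hS s fun p₁ p₂ h => ?_
    exact map_eq_of_eqvSieve_mem hF hs ((hiff _ _).1 ((hqU _ _).1 h))

/-- The Yoneda embedding into sheaves for the canonical topology, in a universe where
sheafification exists. -/
abbrev sheafYoneda (C : Type u) [Category.{w} C] :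
    C ⥤ Sheaf (Sheaf.canonicalTopology C) (Type (max w u)) :=
  GrothendieckTopology.uliftYoneda.{u} (Sheaf.canonicalTopology C)

lemma exists_sheaf_coequalizer (hC : ChainsCover C) {X Y : C} {d c : X ⟶ Y} (r : Y ⟶ X)
    (hd : r ≫ d = 𝟙 Y) (hc : r ≫ c = 𝟙 Y) :
    ∃ (Z : C) (q : Y ⟶ Z) (hq : (sheafYoneda C).map d ≫ (sheafYoneda C).map q =
      (sheafYoneda C).map c ≫ (sheafYoneda C).map q),
      Nonempty (IsColimit (Cofork.ofπ ((sheafYoneda C).map q) hq)) := by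
  obtain ⟨Z, q, hq, h⟩ := exists_quotient hC r hd hc
  refine ⟨Z, q, by rw [← Functor.map_comp, hq, Functor.map_comp], ⟨?_⟩⟩
  refine Cofork.IsColimit.ofExistsUnique fun t => ?_
  let ε {V : C} := (Sheaf.canonicalTopology C).uliftYonedaEquiv (X := V) (F := t.pt)
  have hε {V V' : C} (g : V' ⟶ V) (f : (sheafYoneda C).obj V ⟶ t.pt) :
      ε ((sheafYoneda C).map g ≫ f) = t.pt.obj.map g.op (ε f) :=
    ((Sheaf.canonicalTopology C).uliftYonedaEquiv_naturality f g).symm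
  obtain ⟨z, hz, huniq⟩ := h t.pt.obj ((isSheaf_iff_isSheaf_of_type _ _).1 t.pt.property)
    (ε t.π) (by rw [← hε, ← hε, t.condition])
  refine ⟨ε.symm z, ?_, fun m hm => ?_⟩
  · apply ε.injective
    refine (hε _ _).trans ?_
    rw [Equiv.apply_symm_apply, hz]
  · rw [Equiv.eq_symm_apply]
    exact huniq _ ((hε q m).symm.trans (congrArg ε hm))

end Exact

/-! ### Exactness from covers by chains -/

section Completion

variable (C : Type u) [Category.{w} C]

/-- Presheaves of small sets, regarded as presheaves in a universe where sheafification exists. -/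
abbrev presheafULift : (Cᵒᵖ ⥤ Type w) ⥤ Cᵒᵖ ⥤ Type (max w u) :=
  (Functor.whiskeringRight Cᵒᵖ (Type w) (Type (max w u))).obj uliftFunctor.{u, w}

/-- The universe lift of presheaves is fully faithful. -/
def presheafULiftFullyFaithful : (presheafULift.{w, u} C).FullyFaithful :=
  fullyFaithfulULiftFunctor.whiskeringRight Cᵒᵖ

instance : PreservesFiniteLimits (presheafULift.{w, u} C) := ⟨fun _ _ _ => inferInstance⟩

/-- Sheafification, for the canonical topology, of presheaves of small sets. -/
abbrev canonicalSheafification :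
    (Cᵒᵖ ⥤ Type w) ⥤ Sheaf (Sheaf.canonicalTopology C) (Type (max w u)) :=
  presheafULift.{w, u} C ⋙ presheafToSheaf _ _

instance : PreservesFiniteLimits (canonicalSheafification.{w, u} C) :=
  comp_preservesFiniteLimits _ _

/-- Representable presheaves are sheaves. -/
def yonedaCompCanonicalSheafification :
    yoneda ⋙ canonicalSheafification.{w, u} C ≅ sheafYoneda C :=
  Functor.isoWhiskerLeft (sheafYoneda C) (asIso (sheafificationAdjunction _ _).counit)

instance : PreservesFiniteLimits (sheafYoneda.{w, u} C) := by
  have : PreservesFiniteLimits (yoneda ⋙ canonicalSheafification.{w, u} C) :=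
    ⟨fun _ _ _ => comp_preservesLimitsOfShape _ _⟩
  exact preservesFiniteLimits_of_natIso (yonedaCompCanonicalSheafification C)

/-- Presheaves whose sheafification is representable. -/
abbrev representableSheafification : ObjectProperty (Cᵒᵖ ⥤ Type w) :=
  (sheafYoneda C).essImage.inverseImage (canonicalSheafification.{w, u} C)

variable {C}

/-- Full faithfulness of Yoneda turns the sheafified pair into a reflexive pair in `C`.
Sheafification preserves the presheaf coequaliser, which is thereby identified with the
representable one of `exists_sheaf_coequalizer`. -/
lemma prop_of_coequalizer [BarrExact C] (hC : ChainsCover C) {P Q : Cᵒᵖ ⥤ Type w} {a b : P ⟶ Q}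
    (r : Q ⟶ P) (ha : r ≫ a = 𝟙 Q) (hb : r ≫ b = 𝟙 Q) (hP : representableSheafification C P)
    (hQ : representableSheafification C Q) {t : Cofork a b} (ht : IsColimit t) :
    representableSheafification C t.pt := by
  obtain ⟨X, ⟨e⟩⟩ := hP
  obtain ⟨Y, ⟨i⟩⟩ := hQ
  let A := canonicalSheafification.{w, u} C
  let y := sheafYoneda C
  let d : X ⟶ Y := y.preimage (e.hom ≫ A.map a ≫ i.inv)
  let c : X ⟶ Y := y.preimage (e.hom ≫ A.map b ≫ i.inv)
  let s : Y ⟶ X := y.preimage (i.hom ≫ A.map r ≫ e.inv)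
  have hd : s ≫ d = 𝟙 Y := by
    apply y.map_injective
    simp only [d, s, Functor.map_comp, Functor.map_preimage, Category.assoc,
      Iso.inv_hom_id_assoc]
    rw [← A.map_comp_assoc, ha, A.map_id, Category.id_comp, Iso.hom_inv_id, y.map_id]
  have hc : s ≫ c = 𝟙 Y := by
    apply y.map_injective
    simp only [c, s, Functor.map_comp, Functor.map_preimage, Category.assoc,
      Iso.inv_hom_id_assoc]
    rw [← A.map_comp_assoc, hb, A.map_id, Category.id_comp, Iso.hom_inv_id, y.map_id]
  obtain ⟨Z, q, hq, ⟨hZ⟩⟩ := exists_sheaf_coequalizer hC s hd hc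
  have hA := isColimitCoforkMapOfIsColimit A t.condition
    (IsColimit.ofIsoColimit ht (Cofork.isoCoforkOfπ t))
  refine ⟨Z, ⟨IsColimit.coconePointsIsoOfNatIso hZ hA (parallelPair.ext e i ?_ ?_)⟩⟩
  · simp [d, y, A]
  · simp [c, y, A]

lemma prop_of_weighted [BarrExact C] (hC : ChainsCover C) {K : Type*} [Category.{w} K]
    (v : WalkingReflexivePair ⥤ K) {W : Kᵒᵖ ⥤ Type w}
    {π : yoneda.obj (v.obj WalkingReflexivePair.zero) ⟶ W}
    {e : yoneda.map (v.map WalkingReflexivePair.Hom.left) ≫ π =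
      yoneda.map (v.map WalkingReflexivePair.Hom.right) ≫ π}
    (h : IsColimit (Cofork.ofπ π e)) {D : K ⥤ Cᵒᵖ ⥤ Type w}
    (hD : ∀ k, representableSheafification C (D.obj k)) {s : Cocone (weightedDiagram W D)}
    (hs : IsColimit s) : representableSheafification C s.pt :=
  prop_of_coequalizer hC ((v ⋙ D).map WalkingReflexivePair.Hom.reflexion)
    (WalkingReflexivePair.map_reflexion_comp_map_left (v ⋙ D))
    (WalkingReflexivePair.map_reflexion_comp_map_right (v ⋙ D)) (hD _) (hD _)
    (isColimitOfWeighted h hs)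

lemma isLexClosed_representableSheafification [BarrExact C] (hC : ChainsCover C) :
    IsLexClosed reflexiveCoequalizerClass.{w} C (representableSheafification C) where
  yoneda_mem X := ⟨X, ⟨((yonedaCompCanonicalSheafification C).app X).symm⟩⟩
  limits_mem J _ _ := inferInstance
  lexColimits_mem φ hφ D _ hD s hs := by
    obtain rfl := hφ
    exact prop_of_weighted (K := FreeLex.{w} WalkingReflexivePair) hC (freeLexUnit.{w} _)
      (coequalizerIsCoequalizer _ _) hD hs

lemma isLexClosed_lexClosure (Φ : Set LexWeight.{w}) : IsLexClosed Φ C (lexClosure Φ C) where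
  yoneda_mem X _ hQ := hQ.yoneda_mem X
  limits_mem J _ _ := ⟨fun _ ⟨h⟩ _ hQ =>
    have := hQ.limits_mem J
    (h.ofLE fun _ hP => hP _ hQ).prop⟩
  lexColimits_mem φ hφ D hD hmem c hc Q hQ :=
    hQ.lexColimits_mem φ hφ D hD (fun k => hmem k Q hQ) c hc

instance (Φ : Set LexWeight.{w}) (J : Type) [SmallCategory J] [FinCategory J] :
    (lexClosure Φ C).IsClosedUnderLimitsOfShape J :=
  (isLexClosed_lexClosure Φ).limits_mem J

instance (Φ : Set LexWeight.{w}) : PreservesFiniteLimits (lexClosure Φ C).ι :=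
  ⟨fun _ _ _ => inferInstance⟩

instance (Φ : Set LexWeight.{w}) : HasFiniteLimits (Completion Φ C) :=
  ⟨fun _ _ _ => inferInstance⟩

/-- By minimality of the closure, sheafification on the completion factors through Yoneda; the
factor `L` is lex because Yoneda, being fully faithful, reflects limits. -/
theorem isExact_of_chainsCover [BarrExact C] (hC : ChainsCover C) :
    IsExact reflexiveCoequalizerClass.{w} C := by
  let A := canonicalSheafification.{w, u} C
  let y := sheafYoneda C
  let ι := (lexClosure reflexiveCoequalizerClass.{w} C).ι
  have h (P : Completion reflexiveCoequalizerClass.{w} C) : y.essImage ((ι ⋙ A).obj P) :=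
    P.property _ (isLexClosed_representableSheafification hC)
  let L : Completion reflexiveCoequalizerClass.{w} C ⥤ C :=
    Functor.essImage.liftFunctor (ι ⋙ A) y h
  let i : ι ⋙ A ≅ L ⋙ y := (Functor.essImage.liftFunctorCompIso (ι ⋙ A) y h).symm
  have : PreservesFiniteLimits (ι ⋙ A) := comp_preservesFiniteLimits _ _
  have : PreservesFiniteLimits (L ⋙ y) := preservesFiniteLimits_of_natIso i
  refine ⟨L, ⟨?_⟩, preservesFiniteLimits_of_reflects_of_preserves L y⟩
  exact (sheafificationAdjunction _ _).restrictFullyFaithful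
    (iC := ι ⋙ presheafULift.{w, u} C)
    ((ObjectProperty.fullyFaithfulι _).comp (presheafULiftFullyFaithful C))
    ((Sheaf.canonicalTopology C).fullyFaithfulUliftYoneda) i (Iso.refl _)

end Completion

/-! ### The universal property of the free category with finite limits -/

section FreeLex

variable (A : Type) [SmallCategory A] [FinCategory A]

/-- The inclusion of the skeleton of finite sets into sets. -/
abbrev skeletonIncl : FintypeCat.Skeleton.{w} ⥤ Type w :=
  FintypeCat.Skeleton.equivalence.functor ⋙ FintypeCat.incl

/-- Functors valued in the skeleton of finite sets, as functors valued in sets. -/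
abbrev copresheafIncl : (A ⥤ FintypeCat.Skeleton.{w}) ⥤ A ⥤ Type w :=
  (Functor.whiskeringRight A _ _).obj skeletonIncl

instance : PreservesFiniteColimits (copresheafIncl.{w} A) := ⟨fun _ _ _ => inferInstance⟩

instance : PreservesFiniteLimits (copresheafIncl.{w} A).op := preservesFiniteLimits_op _

/-- The generating object at `a` of the free category with finite limits is the corepresentable
functor at `a`. -/
def freeLexUnitIso :
    (freeLexUnit.{w} A).leftOp ⋙ copresheafIncl A ≅ uliftCoyoneda.{w} (C := A) :=
  Functor.isoWhiskerLeft (finCoyoneda.{w} A) ((Functor.whiskeringRight A _ _).mapIso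
    (Functor.isoWhiskerRight FintypeCat.Skeleton.equivalence.counitIso FintypeCat.incl)) ≪≫
    NatIso.ofComponents (fun a => NatIso.ofComponents (fun b => Iso.refl _))

variable {A} {C : Type u} [Category.{w} C] (F : A ⥤ Cᵒᵖ ⥤ Type w)

/-- The extension of a diagram of presheaves on a finite category to the free category with finite
limits. -/
def lexExtension : FreeLex.{w} A ⥤ Cᵒᵖ ⥤ Type w :=
  (copresheafIncl.{w} A).op ⋙ coyoneda ⋙
    (Functor.whiskeringLeft Cᵒᵖ (A ⥤ Type w) (Type w)).obj F.flip

/-- The value at `P` and `c` is the set of maps from `P` to `F.flip.obj c`. Finite limits in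
`FreeLex A` are finite colimits of copresheaves, which such a hom-functor turns into limits. -/
instance : PreservesFiniteLimits (lexExtension F) :=
  have : PreservesFiniteLimits (coyoneda ⋙
    (Functor.whiskeringLeft Cᵒᵖ (A ⥤ Type w) (Type w)).obj F.flip) :=
    comp_preservesFiniteLimits _ _
  comp_preservesFiniteLimits _ _

/-- The extension of a diagram to the free category with finite limits restricts to the diagram. -/
def freeLexUnitCompLexExtension : freeLexUnit.{w} A ⋙ lexExtension F ≅ F :=
  NatIso.ofComponents (fun a => NatIso.ofComponents (fun c => Equiv.toIso
    (((freeLexUnitIso.{w} A).app (op a)).homFromEquiv.trans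
      (uliftCoyonedaEquiv.{w} (F := F.flip.obj c)))) (fun {c c'} f => by
        ext θ
        refine (congrArg uliftCoyonedaEquiv.{w} (Category.assoc
          ((freeLexUnitIso.{w} A).inv.app (op a)) θ (F.flip.map f)).symm).trans ?_
        exact uliftCoyonedaEquiv_comp _ (F.flip.map f))) (fun {a a'} f => by
        ext c θ
        have h := (freeLexUnitIso.{w} A).inv.naturality f.op
        refine (congrArg uliftCoyonedaEquiv.{w} ((Category.assoc _ _ θ).symm.trans
          ((congrArg (· ≫ θ) h).symm.trans (Category.assoc _ _ θ)))).trans ?_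
        exact (uliftCoyonedaEquiv_naturality (F := F.flip.obj c)
          ((freeLexUnitIso.{w} A).inv.app (op a) ≫ θ) f).symm)

variable (P : FreeLex.{w} A)

/-- A functor valued in the skeleton of finite sets, as a functor to sets in the lowest
universe. -/
def smallCopresheaf : A ⥤ Type where
  obj a := Fin (P.unop.obj a).len
  map f := TypeCat.ofHom fun i => (P.unop.map f ⟨i⟩).down
  map_id a := by
    refine ConcreteCategory.hom_ext _ _ fun i => ?_
    exact congrArg ULift.down (congrFun (P.unop.map_id a) ⟨i⟩)
  map_comp f g := by
    refine ConcreteCategory.hom_ext _ _ fun i => ?_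
    exact congrArg ULift.down (congrFun (P.unop.map_comp f g) ⟨i⟩)

instance : Fintype (smallCopresheaf P).Elements :=
  inferInstanceAs (Fintype (Σ a, Fin (P.unop.obj a).len))

instance : FinCategory (smallCopresheaf P).Elements where
  fintypeHom p q := by
    have : Finite (p ⟶ q) := Finite.of_injective (fun f : p ⟶ q => f.val) Subtype.val_injective
    exact Fintype.ofFinite _

/-- The cone exhibiting the value of the extension at `P` as the limit of `F` weighted by `P`. -/
def lexExtensionCone : Cone (CategoryOfElements.π (smallCopresheaf P) ⋙ F) where
  pt := (lexExtension F).obj P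
  π :=
    { app := fun p =>
        { app := fun c => TypeCat.ofHom fun θ : (copresheafIncl A).obj P.unop ⟶ F.flip.obj c =>
            θ.app p.1 ⟨p.2⟩
          naturality := fun c c' f => rfl }
      naturality := fun p q h => by
        ext c θ
        have h₁ : θ.app q.1 _ = (F.map h.val).app c (θ.app p.1 ⟨p.2⟩) :=
          NatTrans.naturality_apply (F := (copresheafIncl A).obj P.unop) (G := F.flip.obj c)
            θ h.val ⟨p.2⟩
        refine Eq.trans ?_ h₁
        exact congrArg (fun i => θ.app q.1 ⟨i⟩) h.property.symm }

/-- The value of the extension at `P` is the limit of `F` weighted by `P`. -/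
def isLimitLexExtensionCone : IsLimit (lexExtensionCone F P) where
  lift s :=
    { app := fun c => TypeCat.ofHom fun x =>
        show (copresheafIncl A).obj P.unop ⟶ F.flip.obj c from
        { app := fun a => TypeCat.ofHom fun i : ULift (Fin (P.unop.obj a).len) =>
            (s.π.app ⟨a, i.down⟩).app c x
          naturality := fun a a' f => by
            refine ConcreteCategory.hom_ext _ _ fun i => ?_
            let k : Functor.elementsMk (smallCopresheaf P) a i.down ⟶
                ⟨a', (P.unop.map f i).down⟩ := ⟨f, rfl⟩
            exact (ConcreteCategory.congr_hom (NatTrans.congr_app (s.w k) c) x).symm }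
      naturality := fun c c' f => by
        refine ConcreteCategory.hom_ext _ _ fun x => ?_
        refine NatTrans.ext (funext fun a => ?_)
        refine ConcreteCategory.hom_ext _ _ fun i => ?_
        exact NatTrans.naturality_apply (s.π.app ⟨a, i.down⟩) f x }
  fac s p := rfl
  uniq s m hm := by
    ext c x
    refine NatTrans.ext (funext fun a => ?_)
    refine ConcreteCategory.hom_ext _ _ fun i => ?_
    exact ConcreteCategory.congr_hom (NatTrans.congr_app (hm ⟨a, i.down⟩) c) x

/-- The value at `P` is a limit of values of `F` over the finite category of elements of `P`.
Closure concerns shapes in `Type`, whence `smallCopresheaf`. -/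
lemma lexExtension_mem {Q : ObjectProperty (Cᵒᵖ ⥤ Type w)}
    (hQ : ∀ (J : Type) [SmallCategory J] [FinCategory J], Q.IsClosedUnderLimitsOfShape J)
    (hF : ∀ a, Q (F.obj a)) : Q ((lexExtension F).obj P) :=
  have := hQ (smallCopresheaf P).Elements
  Q.prop_of_isLimit (isLimitLexExtensionCone F P) fun _ => hF _

end FreeLex

/-! ### Closure properties of the completion -/

section Closure

variable {C : Type u} [Category.{w} C]

/-- The closure is only assumed for pairs arising from lex functors on the free lex category. Every
reflexive pair extends to such a functor, whose values are finite limits of `P` and `Q` and so stay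
in the closure. -/
lemma lexClosure_of_coequalizer {P Q : Cᵒᵖ ⥤ Type w} {a b : P ⟶ Q} (r : Q ⟶ P)
    (ha : r ≫ a = 𝟙 Q) (hb : r ≫ b = 𝟙 Q) (hP : lexClosure reflexiveCoequalizerClass.{w} C P)
    (hQ : lexClosure reflexiveCoequalizerClass.{w} C Q) {t : Cofork a b} (ht : IsColimit t) :
    lexClosure reflexiveCoequalizerClass.{w} C t.pt := by
  let F : WalkingReflexivePair ⥤ Cᵒᵖ ⥤ Type w := reflexivePair a b r
  have hF (k : WalkingReflexivePair) : lexClosure reflexiveCoequalizerClass.{w} C (F.obj k) := by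
    cases k
    · exact hQ
    · exact hP
  let v := freeLexUnit.{w} WalkingReflexivePair
  let i : v ⋙ lexExtension F ≅ F := freeLexUnitCompLexExtension F
  let α : parallelPair ((lexExtension F).map (v.map WalkingReflexivePair.Hom.left))
      ((lexExtension F).map (v.map WalkingReflexivePair.Hom.right)) ≅ parallelPair a b :=
    parallelPair.ext (i.app _) (i.app _) (i.hom.naturality WalkingReflexivePair.Hom.left)
      (i.hom.naturality WalkingReflexivePair.Hom.right)
  have hlex : PreservesFiniteLimits (lexExtension F) := inferInstance
  obtain ⟨s, hs, ⟨hs'⟩⟩ := exists_weighted_isColimit (D := lexExtension F)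
    (coequalizerIsCoequalizer (yoneda.map (v.map WalkingReflexivePair.Hom.left))
      (yoneda.map (v.map WalkingReflexivePair.Hom.right)))
    ((IsColimit.precomposeHomEquiv α t).symm ht)
  have := (isLexClosed_lexClosure (C := C) reflexiveCoequalizerClass.{w}).lexColimits_mem
    reflexiveCoequalizerWeight rfl (lexExtension F) hlex
    (fun k => lexExtension_mem F k (fun J _ _ => inferInstance) hF) s hs'
  rw [hs] at this
  exact this

end Closure

/-! ### Local bijectivity of the unit -/

section LocalIso

variable {C : Type u} [Category.{w} C]

/-- The sieve on which a generalized element lifts along a morphism into a representable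
presheaf. -/
def liftSieve {P : Cᵒᵖ ⥤ Type w} {Z : C} (η : P ⟶ yoneda.obj Z) {T : C} (x : T ⟶ Z) :
    Sieve T where
  arrows V g := ∃ p : P.obj (op V), η.app (op V) p = g ≫ x
  downward_closed := by
    rintro V V' g ⟨p, hp⟩ k
    refine ⟨P.map k.op p, ?_⟩
    rw [Category.assoc, ← hp]
    exact NatTrans.naturality_apply η k.op p

/-- The sieve on which two elements of a presheaf agree. -/
def eqSieve {P : Cᵒᵖ ⥤ Type w} {T : C} (p p' : P.obj (op T)) : Sieve T where
  arrows V g := P.map g.op p = P.map g.op p'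
  downward_closed := by
    intro V V' g h k
    rw [op_comp, Functor.map_comp_apply, h, ← Functor.map_comp_apply]

/-- A morphism into a representable presheaf which is locally bijective for the canonical
topology. -/
structure IsLocallyBijective {P : Cᵒᵖ ⥤ Type w} {Z : C} (η : P ⟶ yoneda.obj Z) : Prop where
  lift_mem : ∀ ⦃T : C⦄ (x : T ⟶ Z), liftSieve η x ∈ Sheaf.canonicalTopology C T
  eq_mem : ∀ ⦃T : C⦄ (p p' : P.obj (op T)), η.app (op T) p = η.app (op T) p' →
    eqSieve p p' ∈ Sheaf.canonicalTopology C T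

/-- The restricted Yoneda embedding followed by the inclusion is the Yoneda embedding. -/
def completionUnitCompι (Φ : Set LexWeight.{w}) :
    completionUnit Φ C ⋙ (lexClosure Φ C).ι ≅ yoneda :=
  Iso.refl _

instance (Φ : Set LexWeight.{w}) : (completionUnit Φ C).Full :=
  Functor.Full.of_comp_faithful_iso (completionUnitCompι Φ)

instance (Φ : Set LexWeight.{w}) : (completionUnit Φ C).Faithful :=
  Functor.Faithful.of_comp_iso (completionUnitCompι Φ)

variable {Φ : Set LexWeight.{w}} {L : Completion Φ C ⥤ C}

/-- Representables are local objects for the morphisms inverted by the left adjoint. -/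
lemma bijective_precomp_of_isIso_map (adj : L ⊣ completionUnit Φ C) {P Q : Completion Φ C}
    (f : P ⟶ Q) [IsIso (L.map f)] (W : C) :
    Function.Bijective fun u : Q ⟶ (completionUnit Φ C).obj W => f ≫ u := by
  constructor
  · intro u v h
    apply (adj.homEquiv _ _).symm.injective
    rw [← cancel_epi (L.map f), ← adj.homEquiv_naturality_left_symm,
      ← adj.homEquiv_naturality_left_symm]
    exact congrArg _ h
  · intro h
    refine ⟨adj.homEquiv _ _ (inv (L.map f) ≫ (adj.homEquiv _ _).symm h), ?_⟩
    dsimp only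
    rw [← adj.homEquiv_naturality_left, IsIso.hom_inv_id_assoc, Equiv.apply_symm_apply]

/-- A compatible family on the image sieve `S` of `f`, composed with the surjection from `P` onto
`S`, is a map from `P` to a representable; locality extends it uniquely along `f`. -/
lemma isSheafFor_of_isIso_map (adj : L ⊣ completionUnit Φ C) {P : Completion Φ C} {T : C}
    (f : P ⟶ (completionUnit Φ C).obj T) [IsIso (L.map f)] {S : Sieve T}
    (hS : ∀ ⦃V : C⦄ (g : V ⟶ T), S g ↔ ∃ p : P.obj.obj (op V), f.hom.app (op V) p = g) (W : C) :
    Presieve.IsSheafFor (yoneda.obj W) S.arrows := by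
  rw [isSheafFor_yoneda_iff]
  intro x hx
  obtain ⟨φ, hφ⟩ : ∃ φ : ∀ V : C, P.obj.obj (op V) → (V ⟶ T),
      ∀ V p, φ V p = f.hom.app (op V) p := ⟨_, fun _ _ => rfl⟩
  have hmem (V : C) (p : P.obj.obj (op V)) : S (φ V p) := (hS _).2 ⟨p, (hφ V p).symm⟩
  have hnat {V V' : C} (k : V' ⟶ V) (p : P.obj.obj (op V)) :
      φ V' (P.obj.map k.op p) = k ≫ φ V p := by
    rw [hφ, hφ]
    exact NatTrans.naturality_apply f.hom k.op p
  have hcongr {V : C} {g g' : V ⟶ T} (hg : S g) (h : g = g') : x g hg = x g' (h ▸ hg) := by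
    subst h
    rfl
  let h : P ⟶ (completionUnit Φ C).obj W := ObjectProperty.homMk
    { app := fun V => TypeCat.ofHom fun p => x (φ V.unop p) (hmem _ p)
      naturality := fun V V' k => by
        refine ConcreteCategory.hom_ext _ _ fun p => ?_
        exact (hcongr _ (hnat k.unop p)).trans (hx _ (hmem _ p) k.unop) }
  have hcomp (t : T ⟶ W) : f ≫ (completionUnit Φ C).map t = h ↔
      ∀ ⦃V : C⦄ (g : V ⟶ T) (hg : S g), g ≫ t = x g hg := by
    constructor
    · intro e V g hg
      obtain ⟨p, hp⟩ := (hS g).1 hg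
      have h₁ := ConcreteCategory.congr_hom
        (NatTrans.congr_app (congrArg (fun k => k.hom) e) (op V)) p
      have h₂ : φ V p = g := (hφ V p).trans hp
      rw [← hcongr (hmem V p) h₂]
      refine Eq.trans ?_ h₁
      exact congrArg (· ≫ t) hp.symm
    · intro ht
      refine ObjectProperty.hom_ext _ (NatTrans.ext (funext fun V => ?_))
      refine ConcreteCategory.hom_ext _ _ fun p => ?_
      refine Eq.trans ?_ (ht (φ V.unop p) (hmem _ p))
      exact congrArg (· ≫ t) (hφ V.unop p).symm
  obtain ⟨hinj, hsurj⟩ := bijective_precomp_of_isIso_map adj f W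
  obtain ⟨u, hu⟩ := hsurj h
  obtain ⟨t, rfl⟩ := (completionUnit Φ C).map_surjective u
  refine ⟨t, (hcomp t).1 hu, fun t' ht' => ?_⟩
  exact (completionUnit Φ C).map_injective (hinj (((hcomp t').2 ht').trans hu.symm))

/-- As `L` is lex, it also inverts every pullback of `f`, and the image of such a pullback is the
pulled-back sieve. -/
lemma mem_canonicalTopology_of_isIso_map (adj : L ⊣ completionUnit Φ C)
    [PreservesFiniteLimits L] {P : Completion Φ C} {T : C}
    (f : P ⟶ (completionUnit Φ C).obj T) [IsIso (L.map f)] {S : Sieve T}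
    (hS : ∀ ⦃V : C⦄ (g : V ⟶ T), S g ↔ ∃ p : P.obj.obj (op V), f.hom.app (op V) p = g) :
    S ∈ Sheaf.canonicalTopology C T := by
  rw [mem_canonicalTopology_iff]
  intro Y g W
  have hsq := IsPullback.of_hasPullback f ((completionUnit Φ C).map g)
  have : IsIso (L.map (pullback.snd f ((completionUnit Φ C).map g))) :=
    MorphismProperty.of_isPullback (P := MorphismProperty.isomorphisms C)
      (hsq.map L) ‹IsIso (L.map f)›
  refine isSheafFor_of_isIso_map adj (pullback.snd f ((completionUnit Φ C).map g)) ?_ W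
  intro V k
  have hsq' := (hsq.map (lexClosure Φ C).ι).map ((evaluation _ _).obj (op V))
  refine (hS (k ≫ g)).trans ⟨?_, ?_⟩
  · rintro ⟨p, hp⟩
    obtain ⟨q, hq, hq'⟩ := Types.exists_of_isPullback hsq' p k hp
    exact ⟨q, hq'⟩
  · rintro ⟨q, rfl⟩
    exact ⟨_, ConcreteCategory.congr_hom hsq'.w q⟩

lemma isLocallyBijective_unit (adj : L ⊣ completionUnit Φ C) [PreservesFiniteLimits L]
    (P : Completion Φ C) : IsLocallyBijective (Z := L.obj P) (adj.unit.app P).hom where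
  lift_mem T x := by
    have hsq := IsPullback.of_hasPullback (adj.unit.app P) ((completionUnit Φ C).map x)
    have : IsIso (L.map (pullback.snd (adj.unit.app P) ((completionUnit Φ C).map x))) :=
      MorphismProperty.of_isPullback (P := MorphismProperty.isomorphisms C)
        -- `L` inverts the unit because its right adjoint is fully faithful.
        (hsq.map L) (inferInstanceAs (IsIso (L.map (adj.unit.app P))))
    refine mem_canonicalTopology_of_isIso_map adj
      (pullback.snd (adj.unit.app P) ((completionUnit Φ C).map x)) ?_
    intro V k
    have hsq' := (hsq.map (lexClosure Φ C).ι).map ((evaluation _ _).obj (op V))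
    constructor
    · rintro ⟨p, hp⟩
      obtain ⟨q, hq, hq'⟩ := Types.exists_of_isPullback hsq' p k hp
      exact ⟨q, hq'⟩
    · rintro ⟨q, rfl⟩
      exact ⟨_, ConcreteCategory.congr_hom hsq'.w q⟩
  eq_mem T p p' h := by
    let a : (completionUnit Φ C).obj T ⟶ P := ObjectProperty.homMk (yonedaEquiv.symm p)
    let b : (completionUnit Φ C).obj T ⟶ P := ObjectProperty.homMk (yonedaEquiv.symm p')
    have hη : a ≫ adj.unit.app P = b ≫ adj.unit.app P := by
      refine ObjectProperty.hom_ext _ (yonedaEquiv.injective ?_)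
      refine (yonedaEquiv_comp (yonedaEquiv.symm p) (adj.unit.app P).hom).trans ?_
      refine Eq.trans ?_ (yonedaEquiv_comp (yonedaEquiv.symm p') (adj.unit.app P).hom).symm
      rw [Equiv.apply_symm_apply, Equiv.apply_symm_apply]
      exact h
    have hab : L.map a = L.map b := by
      apply (adj.homEquiv _ _).injective
      rw [adj.homEquiv_unit, adj.homEquiv_unit]
      exact (adj.unit.naturality a).symm.trans (hη.trans (adj.unit.naturality b))
    -- The agreement sieve is the image of this equalizer, which `L` preserves and whose two maps
    -- `L` identifies.
    have : IsIso (L.map (equalizer.ι a b)) :=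
      isIso_limit_cone_parallelPair_of_eq hab
        (isLimitForkMapOfIsLimit L (equalizer.condition a b) (equalizerIsEqualizer a b))
    refine mem_canonicalTopology_of_isIso_map adj (equalizer.ι a b) ?_
    intro V k
    let G := (lexClosure Φ C).ι ⋙ (evaluation _ _).obj (op V)
    have hlim := isLimitForkMapOfIsLimit G (equalizer.condition a b) (equalizerIsEqualizer a b)
    constructor
    · intro hk
      obtain ⟨q, hq, _⟩ := Types.unique_of_type_equalizer _ _ hlim k hk
      exact ⟨q, hq⟩
    · rintro ⟨q, rfl⟩
      exact ConcreteCategory.congr_hom (congrArg G.map (equalizer.condition a b)) q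

end LocalIso

/-! ### Quotients of reflexive pairs in categories exact for reflexive coequalizers -/

section Quotient

variable {C : Type u} [Category.{w} C] {X Y Z : C}

/-- The sieve on which two generalized elements are identified by the equivalence relation
generated by a parallel pair. -/
def pairSieve (d c : X ⟶ Y) {T : C} (a b : T ⟶ Y) : Sieve T where
  arrows V g := Relation.EqvGen (fun x y : V ⟶ Y => ∃ z, z ≫ d = x ∧ z ≫ c = y) (g ≫ a) (g ≫ b)
  downward_closed := by
    intro V V' g h k
    have key {x y : V ⟶ Y} (h : Relation.EqvGen (fun x y => ∃ z, z ≫ d = x ∧ z ≫ c = y) x y) :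
        Relation.EqvGen (fun x y => ∃ z, z ≫ d = x ∧ z ≫ c = y) (k ≫ x) (k ≫ y) := by
      induction h with
      | rel x y h =>
        obtain ⟨z, rfl, rfl⟩ := h
        exact .rel _ _ ⟨k ≫ z, Category.assoc _ _ _, Category.assoc _ _ _⟩
      | refl x => exact .refl _
      | symm x y _ ih => exact .symm _ _ ih
      | trans x y z _ _ ih ih' => exact .trans _ _ _ ih ih'
    rw [Category.assoc, Category.assoc]
    exact key h

/-- `q` is a quotient of the pair `d, c` for the canonical topology: it is a cover, and its kernel
pair is locally the equivalence relation generated by `d, c`. -/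
structure IsLocalQuotient (d c : X ⟶ Y) (q : Y ⟶ Z) : Prop where
  w : d ≫ q = c ≫ q
  pairSieve_mem : ∀ ⦃T : C⦄ (a b : T ⟶ Y), a ≫ q = b ≫ q →
    pairSieve d c a b ∈ Sheaf.canonicalTopology C T
  generateSingleton_mem : Sieve.generateSingleton q ∈ Sheaf.canonicalTopology C Z

lemma comp_eq_of_eqvGen {d c : X ⟶ Y} {k : Y ⟶ Z} (hk : d ≫ k = c ≫ k) {T : C} {a b : T ⟶ Y}
    (h : Relation.EqvGen (fun x y => ∃ z, z ≫ d = x ∧ z ≫ c = y) a b) : a ≫ k = b ≫ k := by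
  induction h with
  | rel x y h =>
    obtain ⟨z, rfl, rfl⟩ := h
    rw [Category.assoc, Category.assoc, hk]
  | refl x => rfl
  | symm x y _ ih => exact ih.symm
  | trans x y z _ _ ih ih' => exact ih.trans ih'

lemma comp_eq_of_pairSieve_mem {d c : X ⟶ Y} {k : Y ⟶ Z} (hk : d ≫ k = c ≫ k) {T : C}
    {a b : T ⟶ Y} (h : pairSieve d c a b ∈ Sheaf.canonicalTopology C T) : a ≫ k = b ≫ k :=
  hom_ext_of_cover h fun V g hg => by
    rw [← Category.assoc, ← Category.assoc]
    exact comp_eq_of_eqvGen hk hg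

lemma effectiveEpi_of_generateSingleton_mem {e : Y ⟶ Z}
    (h : Sieve.generateSingleton e ∈ Sheaf.canonicalTopology C Z) : EffectiveEpi e := by
  rw [← Sieve.effectiveEpimorphic_singleton]
  refine (Sieve.EffectiveEpimorphic.iff_forall_isSheafFor_yoneda _).2 fun W => ?_
  rw [← Sieve.generateSingleton_eq] at h
  exact Sheaf.isSheaf_yoneda_obj W _ h

lemma IsLocalQuotient.nonempty_isColimit {d c : X ⟶ Y} {q : Y ⟶ Z} (h : IsLocalQuotient d c q) :
    Nonempty (IsColimit (Cofork.ofπ q h.w)) := by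
  have := effectiveEpi_of_generateSingleton_mem h.generateSingleton_mem
  have hk (t : Cofork d c) {T : C} (g₁ g₂ : T ⟶ Y) (hg : g₁ ≫ q = g₂ ≫ q) :
      g₁ ≫ t.π = g₂ ≫ t.π :=
    comp_eq_of_pairSieve_mem t.condition (h.pairSieve_mem _ _ hg)
  exact ⟨Cofork.IsColimit.ofExistsUnique fun t => ⟨EffectiveEpi.desc q t.π (hk t),
    EffectiveEpi.fac q t.π (hk t), fun m hm => EffectiveEpi.uniq q t.π (hk t) m hm⟩⟩

/-- The condition that each reflexive pair has a quotient for the canonical topology. -/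
def HasLocalQuotients (C : Type u) [Category.{w} C] : Prop :=
  ∀ ⦃X Y : C⦄ (d c : X ⟶ Y) (r : Y ⟶ X), r ≫ d = 𝟙 Y → r ≫ c = 𝟙 Y →
    ∃ (Z : C) (q : Y ⟶ Z), IsLocalQuotient d c q

/-- Elements of the presheaf coequaliser are generalized elements of `Y` up to zigzags in `d, c`:
local injectivity of `η` controls the kernel pair of the composite, local surjectivity makes it a
cover. -/
lemma IsLocallyBijective.isLocalQuotient {d c : X ⟶ Y} {P : Cᵒᵖ ⥤ Type w} {π : yoneda.obj Y ⟶ P}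
    {e : yoneda.map d ≫ π = yoneda.map c ≫ π} (hπ : IsColimit (Cofork.ofπ π e))
    {η : P ⟶ yoneda.obj Z} (hη : IsLocallyBijective η) :
    IsLocalQuotient d c (yoneda.preimage (π ≫ η)) := by
  have hmap : π ≫ η = yoneda.map (yoneda.preimage (π ≫ η)) := (yoneda.map_preimage _).symm
  generalize yoneda.preimage (π ≫ η) = q at hmap
  have happ {T : C} (a : T ⟶ Y) : η.app (op T) (π.app (op T) a) = a ≫ q :=
    ConcreteCategory.congr_hom (NatTrans.congr_app hmap (op T)) a
  refine ⟨yoneda.map_injective ?_, fun T a b hab => ?_, ?_⟩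
  · rw [yoneda.map_comp, yoneda.map_comp, ← hmap, reassoc_of% e]
  · refine (Sheaf.canonicalTopology C).superset_covering ?_
      (hη.eq_mem (π.app (op T) a) (π.app (op T) b) (by rw [happ, happ, hab]))
    intro V g hg
    have hg : P.map g.op (π.app (op T) a) = P.map g.op (π.app (op T) b) := hg
    refine presheaf_coequalizer_eqvGen hπ (op V) ?_
    exact (NatTrans.naturality_apply π g.op a).trans
      (Eq.trans hg (NatTrans.naturality_apply π g.op b).symm)
  · refine (Sheaf.canonicalTopology C).superset_covering ?_ (hη.lift_mem (𝟙 Z))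
    rintro V g ⟨p, hp⟩
    obtain ⟨a, rfl⟩ := presheaf_coequalizer_surjective hπ (op V) p
    exact ⟨a, (happ a).symm.trans (hp.trans (Category.comp_id g))⟩

lemma hasLocalQuotients_of_isExact [HasFiniteLimits C]
    (h : IsExact reflexiveCoequalizerClass.{w} C) : HasLocalQuotients C := by
  obtain ⟨L, ⟨adj⟩, _⟩ := h
  intro X Y d c r hd hc
  have hy (X : C) : lexClosure reflexiveCoequalizerClass.{w} C (yoneda.obj X) :=
    fun _ hQ => hQ.yoneda_mem X
  have hmem := lexClosure_of_coequalizer (yoneda.map r)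
    (by rw [← yoneda.map_comp, hd, yoneda.map_id]) (by rw [← yoneda.map_comp, hc, yoneda.map_id])
    (hy X) (hy Y) (coequalizerIsCoequalizer (yoneda.map d) (yoneda.map c))
  exact ⟨_, _, (isLocallyBijective_unit adj ⟨_, hmem⟩).isLocalQuotient
    (coequalizerIsCoequalizer (yoneda.map d) (yoneda.map c))⟩

end Quotient

/-! ### Barr-exactness and covering chains from local quotients. -/

section BarrExact

variable {C : Type u} [Category.{w} C] [HasFiniteLimits C] {X Y Z : C}

lemma generateSingleton_mem_iff_isRegularEpi (hC : HasLocalQuotients C) {e : X ⟶ Y} :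
    Sieve.generateSingleton e ∈ Sheaf.canonicalTopology C Y ↔ IsRegularEpi e := by
  constructor
  · intro h
    have := effectiveEpi_of_generateSingleton_mem h
    infer_instance
  · intro _
    -- A regular epimorphism is the coequaliser of its kernel pair, which the diagonal makes
    -- reflexive; so it agrees up to isomorphism with the local quotient `q`, a cover.
    obtain ⟨Z, q, hq⟩ := hC (pullback.fst e e) (pullback.snd e e) (pullback.lift (𝟙 X) (𝟙 X) rfl)
      (pullback.lift_fst _ _ _) (pullback.lift_snd _ _ _)
    obtain ⟨hZ⟩ := hq.nonempty_isColimit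
    obtain ⟨i, hi⟩ := Cofork.IsColimit.desc' (IsKernelPair.of_hasPullback e).toCoequalizer' q hq.w
    have h := (Sheaf.canonicalTopology C).pullback_stable i hq.generateSingleton_mem
    refine (Sheaf.canonicalTopology C).superset_covering ?_ h
    rintro V g ⟨l, hl⟩
    obtain ⟨j, hj⟩ := Cofork.IsColimit.desc' hZ e pullback.condition
    have hj : q ≫ j = e := hj
    have hi : e ≫ i = q := hi
    have hij : i ≫ j = 𝟙 Y := by
      rw [← cancel_epi e, reassoc_of% hi, hj, Category.comp_id]
    refine ⟨l, ?_⟩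
    rw [← hj, reassoc_of% hl, hij]
    exact Category.comp_id g

lemma regular_of_hasLocalQuotients (hC : HasLocalQuotients C) : Regular C where
  hasCoequalizer_of_isKernelPair {X Y Z f g₁ g₂} h := by
    obtain ⟨Q, q, hq⟩ := hC g₁ g₂ (h.lift (𝟙 X) (𝟙 X) rfl) (h.lift_fst _ _ _) (h.lift_snd _ _ _)
    obtain ⟨hQ⟩ := hq.nonempty_isColimit
    exact ⟨⟨⟨_, hQ⟩⟩⟩
  regularEpiIsStableUnderBaseChange :=
    { of_isPullback := by
        intro X Y Y' S f g f' g' hsq hg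
        rw [MorphismProperty.regularEpi_iff, ← generateSingleton_mem_iff_isRegularEpi hC] at hg ⊢
        refine (Sheaf.canonicalTopology C).superset_covering ?_
          ((Sheaf.canonicalTopology C).pullback_stable f hg)
        rintro V k ⟨l, hl⟩
        exact ⟨hsq.lift l k hl, hsq.lift_snd _ _ _⟩ }

lemma barrExact_of_hasLocalQuotients (hC : HasLocalQuotients C) : BarrExact C where
  toRegular := regular_of_hasLocalQuotients hC
  exists_isKernelPair {R X} p₁ p₂ hR := by
    obtain ⟨⟨E⟩⟩ := hR
    obtain ⟨Z, q, hq⟩ := hC p₁ p₂ E.r E.reflexivity₁ E.reflexivity₂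
    have hmono : Mono (prod.lift p₁ p₂) := by
      refine ⟨fun f g h => E.right_cancellation f g ?_ ?_⟩
      · simpa [prod.lift_fst] using congrArg (· ≫ prod.fst) h
      · simpa [prod.lift_snd] using congrArg (· ≫ prod.snd) h
    have heqv (T : C) : Equivalence fun x y : T ⟶ X => ∃ z, z ≫ p₁ = x ∧ z ≫ p₂ = y :=
      { refl x := ⟨x ≫ E.r, by simp, by simp⟩
        symm := by
          rintro _ _ ⟨z, rfl, rfl⟩
          exact ⟨z ≫ E.s, by rw [Category.assoc, E.symmetry₁], by rw [Category.assoc, E.symmetry₂]⟩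
        trans := by
          rintro _ _ _ ⟨z, rfl, hz⟩ ⟨z', rfl, rfl⟩
          obtain ⟨l, hl, hl'⟩ := PullbackCone.IsLimit.lift' E.isLimit z z' hz
          exact ⟨l ≫ E.t, by rw [Category.assoc, E.transitivity₁, reassoc_of% hl],
            by rw [Category.assoc, E.transitivity₂, reassoc_of% hl']⟩ }
    -- The pair is already an equivalence relation on generalized elements, so the local zigzags
    -- collapse to local lifts, which glue because `prod.lift p₁ p₂` is monic.
    have hlift {T : C} (a b : T ⟶ X) (hab : a ≫ q = b ≫ q) : ∃ l, l ≫ p₁ = a ∧ l ≫ p₂ = b := by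
      obtain ⟨l, hl⟩ := exists_lift_of_cover (hq.pairSieve_mem a b hab) (prod.lift p₁ p₂)
        (prod.lift a b) fun V g hg => by
          obtain ⟨z, hz, hz'⟩ := (heqv V).eqvGen_iff.1 hg
          exact ⟨z, by rw [prod.comp_lift, prod.comp_lift, hz, hz']⟩
      refine ⟨l, ?_, ?_⟩
      · simpa [prod.lift_fst] using congrArg (· ≫ prod.fst) hl
      · simpa [prod.lift_snd] using congrArg (· ≫ prod.snd) hl
    exact ⟨Z, q, ⟨hq.w⟩, ⟨PullbackCone.IsLimit.mk _ (fun s => (hlift _ _ s.condition).choose)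
      (fun s => (hlift _ _ s.condition).choose_spec.1)
      (fun s => (hlift _ _ s.condition).choose_spec.2)
      fun s m hm hm' => E.right_cancellation _ _
        (hm.trans (hlift _ _ s.condition).choose_spec.1.symm)
        (hm'.trans (hlift _ _ s.condition).choose_spec.2.symm)⟩⟩

/-- The bound is the kernel pair of the local quotient of the two legs of `R`: its generic pair is
locally joined by zigzags, and each zigzag, being finite, lies in some stage of the chain. -/
lemma chainsCover_of_hasLocalQuotients {C : Type u} [Category.{w} C] [Regular C]
    (hC : HasLocalQuotients C) : ChainsCover C := by
  intro X R hR
  obtain ⟨s, hs, hs'⟩ := holds_iff_exists.1 (hR.holds (𝟙 X))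
  obtain ⟨Z, q, hq⟩ := hC (R.arrow ≫ prod.fst) (R.arrow ≫ prod.snd) s hs hs'
  have hiff {T : C} (a b : T ⟶ X) : eqvSieve R a b = pairSieve (R.arrow ≫ prod.fst)
      (R.arrow ≫ prod.snd) a b := by
    ext V g
    have : (Holds R : (V ⟶ X) → (V ⟶ X) → Prop) =
        fun x y => ∃ z, z ≫ R.arrow ≫ prod.fst = x ∧ z ≫ R.arrow ≫ prod.snd = y := by
      ext x y
      exact holds_iff_exists
    change Relation.EqvGen (Holds R) _ _ ↔ _
    rw [this]
    rfl
  have hU {T : C} (t : T ⟶ X ⨯ X) :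
      (equalizerSubobject (prod.fst ≫ q) (prod.snd ≫ q)).Factors t ↔
        (t ≫ prod.fst) ≫ q = (t ≫ prod.snd) ≫ q := by
    rw [equalizerSubobject_factors_iff, Category.assoc, Category.assoc]
  have hlift {T : C} (t : T ⟶ X ⨯ X) : prod.lift (t ≫ prod.fst) (t ≫ prod.snd) = t := by
    apply prod.hom_ext <;> simp [prod.lift_fst, prod.lift_snd]
  refine ⟨equalizerSubobject (prod.fst ≫ q) (prod.snd ≫ q), fun n => ?_, ?_⟩
  · refine Subobject.le_of_factors ((hU _).2 (comp_eq_of_pairSieve_mem hq.w ?_))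
    rw [← hiff]
    refine eqvSieve_mem_of_holds_relChainAux n ?_
    rw [Holds, hlift]
    exact Subobject.factors_self _
  · rw [← hlift (Subobject.arrow _), chainSieve_relChain_mem_iff, hiff]
    exact hq.pairSieve_mem _ _ ((hU _).1 (Subobject.factors_self _))

end BarrExact

end LexColimits

end

theorem mainTheorem11 (C : Type u) [Category.{w} C] [HasFiniteLimits C] :
    List.TFAE [
      LexColimits.IsExact LexColimits.reflexiveCoequalizerClass.{w} C,
      ∃ _ : LexColimits.BarrExact C, ∀ (X : C) (R : Subobject (X ⨯ X))
        (hR : LexColimits.IsReflexiveRel R),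
        LexColimits.HasStableColimit (LexColimits.relChain R hR),
      ∃ _ : LexColimits.BarrExact C, ∀ (X : C) (R : Subobject (X ⨯ X))
        (hR : LexColimits.IsReflexiveRel R),
        ∃ U : Subobject (X ⨯ X),
          LexColimits.IsStableEffectiveUnion (LexColimits.relChain R hR) U] := by
  tfae_have 1 → 3 := by
    intro h
    have hC := LexColimits.hasLocalQuotients_of_isExact h
    refine ⟨LexColimits.barrExact_of_hasLocalQuotients hC, fun X R hR => ?_⟩
    have := LexColimits.barrExact_of_hasLocalQuotients hC
    obtain ⟨U, hU, hcov⟩ := LexColimits.chainsCover_of_hasLocalQuotients hC X R hR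
    exact ⟨U, LexColimits.isStableEffectiveUnion_of_chainSieve_mem hU hcov⟩
  tfae_have 3 → 2 := by
    rintro ⟨hB, h⟩
    refine ⟨hB, fun X R hR => ?_⟩
    obtain ⟨U, hU⟩ := h X R hR
    exact LexColimits.hasStableColimit_of_chainSieve_mem
      (fun n => hU.1.isLUB.1 (Set.mem_range_self n)) hU.chainSieve_mem
  tfae_have 2 → 1 := by
    rintro ⟨hB, h⟩
    exact LexColimits.isExact_of_chainsCover fun X R hR => (h X R hR).exists_chainSieve_mem
  tfae_finish
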